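/- Let $P$ be a positive densely defined operator with compact inverse on a separable infinite-dimensional complex Hilbert space, whose eigenvalues are $\lambda_n=A(n)$ with multiplicities $M_n=B(n)$, $n\in\mathbb N=\{0,1,2,\dots\}$, where $A$ and $B$ are real polynomials, $B(n)$ is a non-negative integer for every $n\in\mathbb N$, and no root of $A$ lies in $\mathbb N$. (If some of the values $A(n)$ coincide or some $B(n)$ vanish, this means that each $\mu\in\mathbb R$ is an eigenvalue of multiplicity $\sum_{n:A(n)=\mu}B(n)$.) Let $\zeta_P(s)=\operatorname{Tr}P^{-s}$, with domain $\mathrm{Dom}(\zeta_P)$ the set of $s\in\mathbb C$ for which $P^{-s}$ is trace class, and for integers $N>0$ let $\zeta_P^N(s)=\sum_{n\ge N}M_n\lambda_n^{-s}$ be the truncated zeta function on $\mathrm{Dom}(\zeta_P)$. Put $L=(1+\deg B)/\deg A$. Then: 1. $\zeta_P$ is well-defined with abscissa of convergence $L$: $\mathrm{Dom}(\zeta_P)$ is non-empty and contains every $s$ with $\Re s>L$, and the Dirichlet series $\sum_{n\ge 0}M_n e^{-s\log\lambda_n}$ converges for $\Re s>L$ and diverges for $\Re s<L$. 2. $\zeta_P$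 admits a meromorphic extension to all of $\mathbb C$. 3. Every pole of this extension is simple and lies in $$\Big\{\tfrac{1+\deg B-k}{\deg A}:k\in\mathbb N\Big\}\setminus\{-m:m\in\mathbb N\}.$$ 4. For every $\varepsilon>0$ there is an integer $N>0$ such that $\zeta_P^N$ has a meromorphic extension to $\mathbb C$, also denoted $\zeta_P^N$, which satisfies, for every $x\in\mathbb R$, $$|\zeta_P^N(x+iy)|=O\big(e^{\varepsilon|y|}\big)\qquad\text{as } y\to\pm\infty.$$ -/

import Mathlib

universe u

noncomputable section PolynomialSpectrum

variable {H : Type u} [NormedAddCommGroup H] [InnerProductSpace ℂ H]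

/-- The eigenspace `ker (P - μ)` of a (possibly unbounded) operator `P`, as a subspace of `H`. -/
def opEigenspace (P : H →ₗ.[ℂ] H) (μ : ℝ) : Submodule ℂ H :=
  (LinearMap.ker (P.toFun - (μ : ℂ) • P.domain.subtype)).map P.domain.subtype

/-- `P` is a positive densely defined operator with a compact inverse. (Symmetry together with
surjectivity makes such a `P` self-adjoint.) -/
structure IsPositiveWithCompactInverse (P : H →ₗ.[ℂ] H) : Prop where
  dense_domain : Dense (P.domain : Set H)
  symmetric : ∀ x y : P.domain, inner ℂ (P x) (y : H) = inner ℂ (x : H) (P y)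
  nonneg : ∀ x : P.domain, 0 ≤ (inner ℂ (P x) (x : H)).re
  compact_inverse : ∃ K : H →L[ℂ] H, IsCompactOperator K ∧
    (∀ x : P.domain, K (P x) = x) ∧ ∀ y : H, ∃ h : K y ∈ P.domain, P ⟨K y, h⟩ = y

/-- The eigenvalues of `P` are the numbers `lam n`, with multiplicities `M n`: every real `μ` is an
eigenvalue of multiplicity `∑ M n`, the sum over those `n` with `lam n = μ`. When the `lam n` are
distinct this says that `lam n` has multiplicity `M n` and that there are no other eigenvalues. -/
def HasEigenvaluesWithMult (P : H →ₗ.[ℂ] H) (lam : ℕ → ℝ) (M : ℕ → ℕ) : Prop :=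
  ∀ μ : ℝ, {n : ℕ | lam n = μ ∧ M n ≠ 0}.Finite ∧
    Module.finrank ℂ (opEigenspace P μ) = ∑ᶠ (n : ℕ) (_ : lam n = μ), M n

/-- The bounded operator `T` is the complex power `P ^ w` of `P`: on each eigenspace `ker (P - μ)`
it is multiplication by `μ ^ w`. For a positive `P` with compact inverse the eigenspaces span a
dense subspace and all `μ` are positive, so there is at most one such `T`. -/
def IsOpCpow (P : H →ₗ.[ℂ] H) (w : ℂ) (T : H →L[ℂ] H) : Prop :=
  ∀ μ : ℝ, ∀ v ∈ opEigenspace P μ, T v = (μ : ℂ) ^ w • v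

/-- `T` is trace class: `∑ |⟨f i, T (e i)⟩| < ∞` for all orthonormal bases `e`, `f`. -/
def IsTraceClassOp (T : H →L[ℂ] H) : Prop :=
  ∀ (ι : Type u) (e f : HilbertBasis ι ℂ H), Summable fun i => ‖inner ℂ (f i) (T (e i))‖

/-- `T` is trace class with trace `τ`: `τ = ∑ ⟨e i, T (e i)⟩` for every orthonormal basis `e`. -/
def HasOpTrace (T : H →L[ℂ] H) (τ : ℂ) : Prop :=
  IsTraceClassOp T ∧
    ∀ (ι : Type u) (e : HilbertBasis ι ℂ H), HasSum (fun i => inner ℂ (e i) (T (e i))) τ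

/-- The domain of the spectral zeta function: the `s` for which `P ^ (-s)` is trace class. -/
def zetaDom (P : H →ₗ.[ℂ] H) : Set ℂ :=
  {s | ∃ (T : H →L[ℂ] H) (τ : ℂ), IsOpCpow P (-s) T ∧ HasOpTrace T τ}

open Classical in
/-- The spectral zeta function `ζ_P(s) = Tr P ^ (-s)` on `zetaDom P` (and `0` elsewhere). -/
def specZeta (P : H →ₗ.[ℂ] H) (s : ℂ) : ℂ :=
  if h : ∃ τ : ℂ, ∃ T : H →L[ℂ] H, IsOpCpow P (-s) T ∧ HasOpTrace T τ then h.choose else 0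

/-- The truncated zeta function `∑_{n ≥ N} M n * (lam n) ^ (-s)`. -/
def truncZeta (lam : ℕ → ℝ) (M : ℕ → ℕ) (N : ℕ) (s : ℂ) : ℂ :=
  ∑' n : ℕ, (M (n + N) : ℂ) * (lam (n + N) : ℂ) ^ (-s)

/-- Convergence of the general Dirichlet series `∑ a n * exp (-s * b n)` at `s`. -/
def DirichletConverges (a : ℕ → ℂ) (b : ℕ → ℝ) (s : ℂ) : Prop :=
  ∃ l : ℂ, Filter.Tendsto
    (fun k : ℕ => ∑ n ∈ Finset.range k, a n * Complex.exp (-s * (b n : ℂ))) Filter.atTop (nhds l)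

/-- `L` is the abscissa of convergence of `∑ a n * exp (-s * b n)`. -/
def IsDirichletAbscissa (a : ℕ → ℂ) (b : ℕ → ℝ) (L : ℝ) : Prop :=
  (∀ s : ℂ, L < s.re → DirichletConverges a b s) ∧
    ∀ s : ℂ, s.re < L → ¬ DirichletConverges a b s

/-- `Z` is a meromorphic function on the whole plane extending `f` from the set `D`. The normal
form requirement says that `Z` is analytic at every point that is not a pole. -/
def IsMeromorphicExtension (f : ℂ → ℂ) (D : Set ℂ) (Z : ℂ → ℂ) : Prop :=
  MeromorphicNFOn Z Set.univ ∧ Set.EqOn Z f D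

/-- The set of poles of a meromorphic function on the plane. -/
def poleSet (Z : ℂ → ℂ) : Set ℂ := {z | meromorphicOrderAt Z z < 0}

end PolynomialSpectrum

/-! The compact inverse of `P` is symmetric and injective, so the spectral theorem gives a Hilbert
basis of eigenvectors indexed by the pairs `(n, i)` with `i < M n` (`exists_hilbertBasis`). Testing
the trace on this basis shows that `P ^ (-s)` is trace class exactly when `∑ M n * (lam n) ^ (-s)`
is summable, and that the trace is the sum. Everything else concerns this Dirichlet series.

Write `A n = a n ^ d (1 + p (1 / n))` and `B n = n ^ b q (1 / n)` with `p 0 = 0`. Once `n ≥ N`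
forces `|p (1 / n)| ≤ 1 / 2`, expanding `(1 + p) ^ (-s)` to `K` binomial terms turns the tail of the
series, up to the factor `a ^ (-s)`, into a finite sum of zeta tails at `d * s - b + j`, with
coefficients polynomial in `s`, plus a remainder analytic for `Re (d * s - b) + K > 1`
(`exists_norm_binomRemainder_le`). Increasing `K` continues the tail to the plane. Poles come only
from the simple pole of zeta, at `d * s - b + j = 1`. For `s = -m` this forces `j = 1 + b + d * m`,
whereas the coefficient is then that of `q (1 + p) ^ m`, of degree at most `b + d * m`; its zero
cancels the pole (`expansionCoeff_neg_natCast`).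

The tail has polynomial growth on vertical lines because zeta has. The latter follows from the same
expansion applied to the shift `n ↦ n + 1` (`mul_zetaTail_two_add_one`). Hence a single `N` serves
every `ε`.

For `Re s ≤ L`, blocks `[Q m, (Q + 1) m)` of the series have nearly constant phase and sums bounded
away from `0`, which contradicts the Cauchy criterion (`not_dirichletConverges`). -/

open Filter Topology Polynomial InnerProductSpace

/-! ### Binomial expansion with a remainder uniform in vertical strips -/

/-- The generalized binomial coefficient `(-s choose k)`. -/
noncomputable def negBinom : ℕ → ℂ → ℂ
  | 0, _ => 1
  | k + 1, s => -s / (k + 1) * negBinom k (s + 1)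

lemma differentiable_negBinom (k : ℕ) : Differentiable ℂ (negBinom k) := by
  induction k with
  | zero => exact differentiable_const 1
  | succ k ih =>
    have : negBinom (k + 1) = fun s => -s / (k + 1) * negBinom k (s + 1) := rfl
    rw [this]
    exact (differentiable_id.neg.div_const _).mul (ih.comp (differentiable_id.add_const 1))

lemma negBinom_one (s : ℂ) : negBinom 1 s = -s := by simp [negBinom]

/-- The binomial series terminates at these points, which later cancels the poles at `-m`. -/
lemma negBinom_neg_natCast (k m : ℕ) : negBinom k (-(m : ℂ)) = m.choose k := by
  induction k generalizing m with
  | zero => simp [negBinom]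
  | succ k ih =>
    cases m with
    | zero => simp [negBinom]
    | succ m =>
      have h1 : (-((m + 1 : ℕ) : ℂ) + 1) = -(m : ℂ) := by push_cast; ring
      have h2 : ((m + 1 : ℕ) : ℂ) * (m.choose k : ℂ) = ((m + 1).choose (k + 1) : ℂ) * (k + 1) := by
        exact_mod_cast Nat.add_one_mul_choose_eq m k
      have h3 : (k : ℂ) + 1 ≠ 0 := by exact_mod_cast Nat.succ_ne_zero k
      rw [negBinom, h1, ih, neg_neg, div_mul_eq_mul_div, h2, mul_div_cancel_right₀ _ h3]

/-- The remainder after `K` terms of the binomial expansion of `(1 + r) ^ (-s)`. -/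
noncomputable def binomRemainder (K : ℕ) (s : ℂ) (r : ℝ) : ℂ :=
  ((1 + r : ℝ) : ℂ) ^ (-s) - ∑ k ∈ Finset.range K, negBinom k s * (r : ℂ) ^ k

lemma binomRemainder_succ (K : ℕ) (s : ℂ) (r : ℝ) :
    binomRemainder K s r = binomRemainder (K + 1) s r + negBinom K s * (r : ℂ) ^ K := by
  simp only [binomRemainder, Finset.sum_range_succ]; ring

lemma binomRemainder_succ_zero (K : ℕ) (s : ℂ) : binomRemainder (K + 1) s 0 = 0 := by
  simp [binomRemainder, Finset.sum_range_succ', negBinom]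

/-- The recursion defining `negBinom` is made for this: differentiation lowers `K` by one and shifts
`s` by one. -/
lemma hasDerivAt_binomRemainder (K : ℕ) (s : ℂ) {r : ℝ} (hr : -1 < r) :
    HasDerivAt (binomRemainder (K + 1) s) (-s * binomRemainder K (s + 1) r) r := by
  have h1 : HasDerivAt (fun r : ℝ => ((1 + r : ℝ) : ℂ)) 1 r := by
    simpa using ((hasDerivAt_id r).const_add 1).ofReal_comp
  have h2 : HasDerivAt (fun r : ℝ => ((1 + r : ℝ) : ℂ) ^ (-s))
      (-s * ((1 + r : ℝ) : ℂ) ^ (-s - 1) * 1) r := by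
    have := (HasDerivAt.cpow_const (c := -s) (hasDerivAt_id (((1 + r : ℝ) : ℂ)))
      (Or.inl (by simp; linarith)))
    simpa [Function.comp_def] using this.comp r h1
  have h3 : ∀ k ∈ Finset.range (K + 1), HasDerivAt (fun r : ℝ => negBinom k s * (r : ℂ) ^ k)
      (negBinom k s * (k * (r : ℂ) ^ (k - 1))) r := by
    intro k _
    have := (hasDerivAt_pow k (r : ℂ)).comp r (hasDerivAt_id r).ofReal_comp
    simpa [Function.comp_def] using this.const_mul (negBinom k s)
  have h4 := h2.sub (HasDerivAt.fun_sum h3)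
  refine h4.congr_deriv ?_
  rw [Finset.sum_range_succ', binomRemainder, mul_sub, Finset.mul_sum]
  have h5 : -s - 1 = -(s + 1) := by ring
  rw [h5, mul_one]
  simp only [Nat.cast_zero, zero_mul, mul_zero, add_zero]
  congr 1
  refine Finset.sum_congr rfl fun k _ => ?_
  have h3 : (k : ℂ) + 1 ≠ 0 := by exact_mod_cast Nat.succ_ne_zero k
  rw [negBinom]
  push_cast
  field_simp

/-- Induction on `K` by the mean value inequality from `r = 0`, where the remainder vanishes. Each
step costs a factor `‖s‖ * |r|` and needs the previous bound on a strip wider by one, hence the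
general `X`. -/
lemma exists_norm_binomRemainder_le (K : ℕ) (X : ℝ) : ∃ C : ℝ, 0 ≤ C ∧ ∀ s : ℂ, |s.re| ≤ X →
    ∀ r : ℝ, |r| ≤ 1 / 2 → ‖binomRemainder K s r‖ ≤ C * (1 + ‖s‖) ^ K * |r| ^ K := by
  induction K generalizing X with
  | zero =>
    refine ⟨2 ^ X, by positivity, fun s hs r hr => ?_⟩
    have h := abs_le.1 hr
    have h' := abs_le.1 hs
    have h0 : 0 < 1 + r := by linarith
    simp only [binomRemainder, Finset.range_zero, Finset.sum_empty, sub_zero, pow_zero, mul_one]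
    rw [Complex.norm_cpow_eq_rpow_re_of_pos h0, Complex.neg_re]
    rcases le_total 1 (1 + r) with h1 | h1
    · calc (1 + r) ^ (-s.re) ≤ (1 + r) ^ X := Real.rpow_le_rpow_of_exponent_le h1 (by linarith)
        _ ≤ 2 ^ X := Real.rpow_le_rpow h0.le (by linarith) ((abs_nonneg _).trans hs)
    · calc (1 + r) ^ (-s.re) ≤ (1 + r) ^ (-X) :=
          Real.rpow_le_rpow_of_exponent_ge h0 h1 (by linarith)
        _ = ((1 + r)⁻¹) ^ X := by rw [Real.rpow_neg h0.le, Real.inv_rpow h0.le]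
        _ ≤ 2 ^ X := by
          refine Real.rpow_le_rpow (by positivity) ?_ ((abs_nonneg _).trans hs)
          rw [inv_le_comm₀ h0 two_pos]; linarith
  | succ K ih =>
    obtain ⟨C, hC, hb⟩ := ih (X + 1)
    refine ⟨C * 2 ^ K, by positivity, fun s hs r hr => ?_⟩
    have hs1 : |(s + 1).re| ≤ X + 1 := by
      have h' := abs_le.1 hs
      rw [abs_le]; simp; constructor <;> linarith
    have hns : ‖s + 1‖ ≤ ‖s‖ + 1 := by simpa using norm_add_le s 1
    have key : ∀ t ∈ Set.Icc (-|r|) |r|, ‖-s * binomRemainder K (s + 1) t‖ ≤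
        C * 2 ^ K * (1 + ‖s‖) ^ (K + 1) * |r| ^ K := by
      intro t ht
      have ht' : |t| ≤ |r| := abs_le.2 ht
      rw [norm_mul, norm_neg]
      calc ‖s‖ * ‖binomRemainder K (s + 1) t‖
          ≤ (1 + ‖s‖) * (C * (1 + ‖s + 1‖) ^ K * |t| ^ K) := by
            gcongr
            · linarith
            · exact hb _ hs1 t (ht'.trans hr)
        _ ≤ (1 + ‖s‖) * (C * (2 * (1 + ‖s‖)) ^ K * |r| ^ K) := by
            gcongr
            linarith [norm_nonneg s]
        _ = _ := by rw [mul_pow]; ring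
    have := (convex_Icc (-|r|) |r|).norm_image_sub_le_of_norm_hasDerivWithin_le
      (f := binomRemainder (K + 1) s) (x := 0) (y := r) (fun t ht =>
        (hasDerivAt_binomRemainder K s (r := t) (by
          have := ht.1; linarith)).hasDerivWithinAt) key
      (by simp) ⟨neg_abs_le r, le_abs_self r⟩
    rw [binomRemainder_succ_zero, sub_zero, sub_zero, Real.norm_eq_abs] at this
    calc _ ≤ _ := this
      _ = _ := by rw [pow_succ |r|]; ring

lemma differentiable_binomRemainder (K : ℕ) {r : ℝ} (hr : -1 < r) :
    Differentiable ℂ fun s => binomRemainder K s r := by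
  unfold binomRemainder
  refine Differentiable.sub (fun s => ?_) (Differentiable.fun_sum fun k _ =>
    (differentiable_negBinom k).mul_const _)
  refine (differentiable_id.neg s).const_cpow (Or.inl ?_)
  exact_mod_cast (by linarith : (1 : ℝ) + r ≠ 0)

/-! ### Polynomial growth on vertical lines -/

/-- `f` has at most polynomial growth on the vertical line `Re s = x`. -/
def PolyGrowth (f : ℂ → ℂ) (x : ℝ) : Prop :=
  ∃ D : ℕ, (fun y : ℝ => f ((x : ℂ) + (y : ℂ) * Complex.I)) =O[atTop ⊔ atBot] fun y => |y| ^ D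

lemma tendsto_abs_atTop_sup_atBot : Tendsto (fun y : ℝ => |y|) (atTop ⊔ atBot) atTop :=
  tendsto_abs_atTop_atTop.sup tendsto_abs_atBot_atTop

lemma isBigO_abs_pow_of_le {D E : ℕ} (h : D ≤ E) :
    (fun y : ℝ => |y| ^ D) =O[atTop ⊔ atBot] fun y => |y| ^ E := by
  refine Asymptotics.IsBigO.of_bound 1 ?_
  filter_upwards [tendsto_abs_atTop_sup_atBot.eventually_ge_atTop 1] with y hy
  rw [Real.norm_of_nonneg (by positivity), Real.norm_of_nonneg (by positivity), one_mul]
  exact pow_le_pow_right₀ hy h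

namespace PolyGrowth

variable {f g : ℂ → ℂ} {x : ℝ}

lemma congr' (hf : PolyGrowth f x)
    (h : ∀ᶠ y : ℝ in atTop ⊔ atBot,
      f ((x : ℂ) + (y : ℂ) * Complex.I) = g ((x : ℂ) + (y : ℂ) * Complex.I)) :
    PolyGrowth g x := by
  obtain ⟨D, hD⟩ := hf
  exact ⟨D, hD.congr' h EventuallyEq.rfl⟩

lemma add (hf : PolyGrowth f x) (hg : PolyGrowth g x) : PolyGrowth (fun s => f s + g s) x := by
  obtain ⟨D, hD⟩ := hf
  obtain ⟨E, hE⟩ := hg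
  exact ⟨max D E, (hD.trans (isBigO_abs_pow_of_le (le_max_left _ _))).add
    (hE.trans (isBigO_abs_pow_of_le (le_max_right _ _)))⟩

lemma neg (hf : PolyGrowth f x) : PolyGrowth (fun s => -f s) x := by
  obtain ⟨D, hD⟩ := hf
  exact ⟨D, hD.neg_left⟩

lemma sub (hf : PolyGrowth f x) (hg : PolyGrowth g x) : PolyGrowth (fun s => f s - g s) x := by
  simpa only [sub_eq_add_neg] using hf.add hg.neg

lemma mul (hf : PolyGrowth f x) (hg : PolyGrowth g x) : PolyGrowth (fun s => f s * g s) x := by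
  obtain ⟨D, hD⟩ := hf
  obtain ⟨E, hE⟩ := hg
  exact ⟨D + E, (hD.mul hE).congr_right fun y => (pow_add _ _ _).symm⟩

/-- A function dominated on a vertical line by a power of `1 + |s|` has polynomial growth there. -/
lemma of_le {C : ℝ} {D : ℕ} (h : ∀ s : ℂ, s.re = x → ‖f s‖ ≤ C * (1 + ‖s‖) ^ D) :
    PolyGrowth f x := by
  refine ⟨D, ?_⟩
  have h1 : (fun y : ℝ => (1 + ‖(x : ℂ) + (y : ℂ) * Complex.I‖)) =O[atTop ⊔ atBot]
      fun y => |y| := by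
    refine Asymptotics.IsBigO.of_bound (2 + |x|) ?_
    filter_upwards [tendsto_abs_atTop_sup_atBot.eventually_ge_atTop 1] with y hy
    have h2 : ‖(x : ℂ) + (y : ℂ) * Complex.I‖ ≤ |x| + |y| := by
      refine (norm_add_le _ _).trans ?_
      simp
    rw [Real.norm_of_nonneg (by positivity), Real.norm_of_nonneg (by positivity)]
    nlinarith [abs_nonneg x]
  refine (Asymptotics.IsBigO.of_bound C (Eventually.of_forall fun y => ?_)).trans (h1.pow D)
  rw [Real.norm_of_nonneg (by positivity : 0 ≤ (1 + ‖(x : ℂ) + (y : ℂ) * Complex.I‖) ^ D)]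
  exact h _ (by simp)

lemma const (c : ℂ) : PolyGrowth (fun _ => c) x := of_le (C := ‖c‖) (D := 0) fun s _ => by simp

lemma id : PolyGrowth (fun s => s) x := of_le (C := 1) (D := 1) fun s _ => by simp

lemma sum {ι : Type*} {t : Finset ι} {F : ι → ℂ → ℂ} (h : ∀ i ∈ t, PolyGrowth (F i) x) :
    PolyGrowth (fun s => ∑ i ∈ t, F i s) x := by
  classical
  induction t using Finset.induction_on with
  | empty => simpa using const 0
  | insert i t hi ih =>
    simp only [Finset.sum_insert hi]
    exact (h i (by simp)).add (ih fun j hj => h j (by simp [hj]))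

lemma comp_add_ofReal {c : ℝ} (hf : PolyGrowth f (x + c)) : PolyGrowth (fun s => f (s + c)) x := by
  obtain ⟨D, hD⟩ := hf
  refine ⟨D, hD.congr_left fun y => ?_⟩
  congr 1; push_cast; ring

lemma comp_natCast_mul {d : ℕ} (hd : d ≠ 0) (hf : PolyGrowth f (d * x)) :
    PolyGrowth (fun s => f (d * s)) x := by
  obtain ⟨D, hD⟩ := hf
  have hd' : (0 : ℝ) < d := by exact_mod_cast Nat.pos_of_ne_zero hd
  have ht : Tendsto (fun y : ℝ => d * y) (atTop ⊔ atBot) (atTop ⊔ atBot) :=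
    (tendsto_id.const_mul_atTop hd').sup_sup (tendsto_id.const_mul_atBot hd')
  refine ⟨D, ((hD.comp_tendsto ht).congr_left (f₂ := fun y => _) fun y => ?_).trans
    (Asymptotics.IsBigO.of_bound ((d : ℝ) ^ D) (Eventually.of_forall fun y => ?_))⟩
  · simp only [Function.comp]
    congr 1; push_cast; ring
  · simp [abs_mul, mul_pow]

lemma isBigO_exp (hf : PolyGrowth f x) {ε : ℝ} (hε : 0 < ε) :
    (fun y : ℝ => f ((x : ℂ) + (y : ℂ) * Complex.I)) =O[atTop ⊔ atBot]
      fun y => Real.exp (ε * |y|) := by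
  obtain ⟨D, hD⟩ := hf
  refine hD.trans ?_
  have := (isLittleO_pow_exp_pos_mul_atTop D hε).isBigO.comp_tendsto tendsto_abs_atTop_sup_atBot
  simpa [Function.comp_def] using this

end PolyGrowth

lemma polyGrowth_negBinom (k : ℕ) (x : ℝ) : PolyGrowth (negBinom k) x := by
  induction k generalizing x with
  | zero => exact PolyGrowth.const 1
  | succ k ih =>
    have : negBinom (k + 1) = fun s => (-s * (1 / ((k : ℂ) + 1))) * negBinom k (s + (1 : ℝ)) := by
      ext s; rw [negBinom]; push_cast; ring
    rw [this]
    exact ((PolyGrowth.id.neg).mul (PolyGrowth.const _)).mul (ih (x + 1)).comp_add_ofReal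

lemma polyGrowth_ofReal_cpow_neg {t : ℝ} (ht : 0 < t) (x : ℝ) :
    PolyGrowth (fun s => (t : ℂ) ^ (-s)) x :=
  .of_le (C := t ^ (-x)) (D := 0) fun s hs => by
    rw [Complex.norm_cpow_eq_rpow_re_of_pos ht, Complex.neg_re, hs]; simp

/-! ### Zeta tails and polynomials in `1 / n` -/

/-- The tail `∑_{n ≥ N} n ^ (-z)` of the Riemann zeta function. -/
noncomputable def zetaTail (N : ℕ) (z : ℂ) : ℂ :=
  riemannZeta z - ∑ n ∈ Finset.Ico 1 N, (n : ℂ) ^ (-z)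

lemma hasSum_zetaTail {N : ℕ} (hN : 0 < N) {z : ℂ} (hz : 1 < z.re) :
    HasSum (fun n : ℕ => ((n + N : ℕ) : ℂ) ^ (-z)) (zetaTail N z) := by
  have hz0 : z ≠ 0 := by rintro rfl; simp at hz; linarith
  have hs : Summable fun n : ℕ => (n : ℂ) ^ (-z) := by
    simpa [Complex.cpow_neg] using (Complex.summable_one_div_nat_cpow (p := z)).2 hz
  have h1 : HasSum (fun n : ℕ => (n : ℂ) ^ (-z)) (riemannZeta z) := by
    rw [zeta_eq_tsum_one_div_nat_cpow hz]
    convert! hs.hasSum using 3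
    simp [Complex.cpow_neg]
  have h2 := (hasSum_nat_add_iff' (f := fun n : ℕ => (n : ℂ) ^ (-z)) N).2 h1
  have h3 : ∑ n ∈ Finset.range N, (n : ℂ) ^ (-z) = ∑ n ∈ Finset.Ico 1 N, (n : ℂ) ^ (-z) := by
    -- The term `n = 0` is `0 ^ (-z)`, which is `0` because `z ≠ 0`.
    rw [Finset.range_eq_Ico, Finset.sum_eq_sum_Ico_succ_bot hN]
    simp [hz0]
  rwa [h3] at h2

lemma differentiableAt_zetaTail (N : ℕ) {z : ℂ} (hz : z ≠ 1) :
    DifferentiableAt ℂ (zetaTail N) z := by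
  refine (differentiableAt_riemannZeta hz).sub (DifferentiableAt.fun_sum fun n hn => ?_)
  have : (n : ℂ) ≠ 0 := by
    have := (Finset.mem_Ico.1 hn).1
    exact_mod_cast (by omega : n ≠ 0)
  exact (differentiableAt_id.neg).const_cpow (Or.inl this)

lemma exists_forall_abs_eval_inv_le (p : ℝ[X]) :
    ∃ C : ℝ, 0 ≤ C ∧ ∀ n : ℕ, |p.eval (n : ℝ)⁻¹| ≤ C := by
  obtain ⟨C, hC⟩ := (isCompact_Icc (a := (0 : ℝ)) (b := 1)).exists_bound_of_continuousOn
    p.continuous.continuousOn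
  refine ⟨C, (norm_nonneg _).trans (hC 0 (by simp)), fun n => hC _ ⟨by positivity, ?_⟩⟩
  exact Nat.cast_inv_le_one n

lemma exists_forall_abs_eval_inv_le_mul_inv {p : ℝ[X]} (hp : p.coeff 0 = 0) :
    ∃ C : ℝ, 0 ≤ C ∧ ∀ n : ℕ, |p.eval (n : ℝ)⁻¹| ≤ C * (n : ℝ)⁻¹ := by
  obtain ⟨q, rfl⟩ := X_dvd_iff.2 hp
  obtain ⟨C, hC, h⟩ := exists_forall_abs_eval_inv_le q
  refine ⟨C, hC, fun n => ?_⟩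
  rw [eval_mul, eval_X, abs_mul, abs_of_nonneg (by positivity : (0 : ℝ) ≤ (n : ℝ)⁻¹), mul_comm]
  gcongr
  exact h n

lemma coeff_mul_pow_eq_zero {p q : ℝ[X]} (hp : p.coeff 0 = 0) {j K : ℕ} (hj : j < K) :
    (q * p ^ K).coeff j = 0 :=
  X_pow_dvd_iff.1 ((pow_dvd_pow_of_dvd (X_dvd_iff.2 hp) K).mul_left q) j hj

/-- Formally `∑_{n ≥ N} p (1 / n) n ^ (-z)`, through the continuation of the zeta function. -/
noncomputable def polyZetaTail (N : ℕ) (p : ℝ[X]) (z : ℂ) : ℂ :=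
  p.sum fun j c => (c : ℂ) * zetaTail N (z + j)

lemma polyZetaTail_eq_sum_range (N : ℕ) {p : ℝ[X]} {J : ℕ} (hJ : p.natDegree < J) (z : ℂ) :
    polyZetaTail N p z = ∑ j ∈ Finset.range J, (p.coeff j : ℂ) * zetaTail N (z + j) :=
  p.sum_over_range' (by simp) J hJ

/-- Divisibility of `p` by `X ^ K` moves the half-plane of convergence `K` to the left. -/
lemma hasSum_polyZetaTail {N : ℕ} (hN : 0 < N) {p : ℝ[X]} {K : ℕ}
    (hp : ∀ j < K, p.coeff j = 0) {z : ℂ} (hz : 1 < z.re + K) :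
    HasSum (fun n : ℕ => ((p.eval ((n + N : ℕ) : ℝ)⁻¹ : ℝ) : ℂ) * ((n + N : ℕ) : ℂ) ^ (-z))
      (polyZetaTail N p z) := by
  rw [polyZetaTail_eq_sum_range N (Nat.lt_succ_self _)]
  have h : ∀ j ∈ Finset.range (p.natDegree + 1), HasSum
      (fun n : ℕ => (p.coeff j : ℂ) * ((n + N : ℕ) : ℂ) ^ (-(z + j)))
      ((p.coeff j : ℂ) * zetaTail N (z + j)) := by
    intro j _
    rcases lt_or_ge j K with hj | hj
    · simp [hp j hj, hasSum_zero]
    · refine (hasSum_zetaTail hN ?_).mul_left _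
      have : (K : ℝ) ≤ j := by exact_mod_cast hj
      simp; linarith
  convert! hasSum_sum h using 2 with n
  have hn : ((n + N : ℕ) : ℂ) ≠ 0 := by exact_mod_cast (by omega : n + N ≠ 0)
  rw [eval_eq_sum_range, Complex.ofReal_sum, Finset.sum_mul]
  refine Finset.sum_congr rfl fun j _ => ?_
  rw [neg_add, Complex.cpow_add _ _ hn, Complex.cpow_neg _ (j : ℂ), Complex.cpow_natCast]
  push_cast
  rw [inv_pow]; ring

/-- `p` is small at the points `1 / n`, `n ≥ N`, and vanishes at `0`. -/
structure IsSmallFrom (N : ℕ) (p : ℝ[X]) : Prop where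
  pos : 0 < N
  coeff_zero : p.coeff 0 = 0
  abs_le : ∀ n ≥ N, |p.eval (n : ℝ)⁻¹| ≤ 1 / 2

lemma exists_isSmallFrom {p : ℝ[X]} (hp : p.coeff 0 = 0) (N₀ : ℕ) :
    ∃ N ≥ N₀, IsSmallFrom N p := by
  obtain ⟨C, hC, h⟩ := exists_forall_abs_eval_inv_le_mul_inv hp
  obtain ⟨N, hN⟩ := exists_nat_gt (max (2 * C) N₀)
  have h1 : 2 * C < N := (le_max_left _ _).trans_lt hN
  have h2 : N₀ < N := by exact_mod_cast (le_max_right _ _).trans_lt hN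
  refine ⟨N, h2.le, by omega, hp, fun n hn => (h n).trans ?_⟩
  have h3 : (N : ℝ) ≤ n := by exact_mod_cast hn
  have h4 : (0 : ℝ) < n := by linarith
  rw [← div_eq_mul_inv, div_le_iff₀ h4]; linarith

/-! ### Expansion of the Dirichlet series into zeta tails -/

section Expansion

variable (d b N : ℕ) (p q : ℝ[X])

/-- The remainder of the expansion of `∑_{n ≥ N} q (1 / n) n ^ b (n ^ d (1 + p (1 / n))) ^ (-s)`
after `K` terms. -/
noncomputable def expansionTail (K : ℕ) (s : ℂ) : ℂ :=
  ∑' n : ℕ, ((q.eval ((n + N : ℕ) : ℝ)⁻¹ : ℝ) : ℂ) *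
      ((n + N : ℕ) : ℂ) ^ (-(d * s - b)) *
    binomRemainder K s (p.eval ((n + N : ℕ) : ℝ)⁻¹)

/-- The sum `∑_{n ≥ N} q (1 / n) n ^ b (n ^ d (1 + p (1 / n))) ^ (-s)`, continued to the half-plane
`Re (d * s - b) + K > 1` by expanding `K` terms. -/
noncomputable def expansion (K : ℕ) (s : ℂ) : ℂ :=
  ∑ k ∈ Finset.range K, negBinom k s * polyZetaTail N (q * p ^ k) (d * s - b) +
    expansionTail d b N p q K s

variable {d b N p q}

/-- Since `p (1 / n) = O(1 / n)`, the remainder of order `K` gains a factor `n ^ (-K)`. The bound is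
polynomial in `s`, so it yields both analyticity and growth. -/
lemma exists_norm_expansionTail_term_le (hp : IsSmallFrom N p) (K : ℕ) (X : ℝ) :
    ∃ C : ℝ, 0 ≤ C ∧ ∀ s : ℂ, |s.re| ≤ X → ∀ n : ℕ,
      ‖((q.eval ((n + N : ℕ) : ℝ)⁻¹ : ℝ) : ℂ) *
      ((n + N : ℕ) : ℂ) ^ (-(d * s - b)) *
        binomRemainder K s (p.eval ((n + N : ℕ) : ℝ)⁻¹)‖ ≤
      C * (1 + ‖s‖) ^ K * ((n + N : ℕ) : ℝ) ^ (-(d * s.re - b + K)) := by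
  obtain ⟨C₁, hC₁, h₁⟩ := exists_forall_abs_eval_inv_le q
  obtain ⟨C₂, hC₂, h₂⟩ := exists_forall_abs_eval_inv_le_mul_inv hp.coeff_zero
  obtain ⟨C₃, hC₃, h₃⟩ := exists_norm_binomRemainder_le K X
  refine ⟨C₁ * (C₃ * C₂ ^ K), by positivity, fun s hs n => ?_⟩
  have hpos := hp.pos
  set m := n + N with hm
  have hm0 : 0 < m := by omega
  have hm1 : (0 : ℝ) < m := by exact_mod_cast hm0
  rw [norm_mul, norm_mul, Complex.norm_real, Real.norm_eq_abs,
    Complex.norm_natCast_cpow_of_pos hm0]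
  have hre : (-(d * s - b : ℂ)).re = -(d * s.re - b) := by simp
  rw [hre, neg_add, Real.rpow_add hm1, Real.rpow_neg hm1.le (K : ℝ), Real.rpow_natCast]
  calc _ ≤ C₁ * (m : ℝ) ^ (-(d * s.re - b)) *
        (C₃ * (1 + ‖s‖) ^ K * (C₂ * (m : ℝ)⁻¹) ^ K) := by
        gcongr
        · exact h₁ m
        · refine (h₃ s hs _ (hp.abs_le m (by omega))).trans ?_
          gcongr
          exact h₂ m
    _ = _ := by rw [mul_pow, inv_pow]; ring

lemma summable_nat_add_rpow_neg (N : ℕ) {r : ℝ} (hr : 1 < r) :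
    Summable fun n : ℕ => ((n + N : ℕ) : ℝ) ^ (-r) :=
  (summable_nat_add_iff (f := fun n : ℕ => (n : ℝ) ^ (-r)) N).2
    (Real.summable_nat_rpow.2 (by linarith))

lemma summable_expansionTail (hp : IsSmallFrom N p) {K : ℕ} {s : ℂ}
    (hs : 1 < d * s.re - b + K) :
    Summable fun n : ℕ => ((q.eval ((n + N : ℕ) : ℝ)⁻¹ : ℝ) : ℂ) *
      ((n + N : ℕ) : ℂ) ^ (-(d * s - b)) *
      binomRemainder K s (p.eval ((n + N : ℕ) : ℝ)⁻¹) := by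
  obtain ⟨C, -, hC⟩ := exists_norm_expansionTail_term_le (d := d) (b := b) (q := q) hp K |s.re|
  exact .of_norm_bounded ((summable_nat_add_rpow_neg N hs).mul_left _) (hC s le_rfl)

lemma analyticAt_expansionTail (hp : IsSmallFrom N p) {K : ℕ} {s₀ : ℂ}
    (hs : 1 < d * s₀.re - b + K) : AnalyticAt ℂ (expansionTail d b N p q K) s₀ := by
  obtain ⟨r, hr1, hr⟩ := exists_between hs
  set X := ‖s₀‖ + 1
  obtain ⟨C, hC0, hC⟩ := exists_norm_expansionTail_term_le (d := d) (b := b) (q := q) hp K X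
  -- On this bounded neighbourhood the exponent stays above `r > 1`, so one summable majorant serves
  -- every `s`.
  set U : Set ℂ := {s | ‖s‖ < X ∧ r < d * s.re - b + K}
  have hU : IsOpen U := (isOpen_lt continuous_norm continuous_const).inter
    (isOpen_lt continuous_const
      (((continuous_const.mul Complex.continuous_re).sub continuous_const).add continuous_const))
  refine (Complex.differentiableOn_tsum_of_summable_norm (U := U)
    (u := fun n : ℕ => C * (1 + X) ^ K * ((n + N : ℕ) : ℝ) ^ (-r))
    ((summable_nat_add_rpow_neg N hr1).mul_left _) (fun n s _ => ?_) hU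
    (fun n s hs => ?_)).analyticAt (hU.mem_nhds ⟨lt_add_one _, hr⟩)
  · have hpos := hp.pos
    have h1 : ((n + N : ℕ) : ℂ) ≠ 0 := by exact_mod_cast (by omega : n + N ≠ 0)
    have h2 := abs_le.1 (hp.abs_le (n + N) (by omega))
    have h3 : DifferentiableAt ℂ (fun s : ℂ => ((n + N : ℕ) : ℂ) ^ (-(d * s - b))) s :=
      ((differentiableAt_id.const_mul (d : ℂ)).sub_const (b : ℂ)).neg.const_cpow (Or.inl h1)
    exact ((h3.const_mul _).mul
      (differentiable_binomRemainder K (by linarith) s)).differentiableWithinAt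
  · refine (hC s ((Complex.abs_re_le_norm s).trans hs.1.le) n).trans ?_
    have hpos := hp.pos
    have h1 : (1 : ℝ) ≤ (n + N : ℕ) := by exact_mod_cast (by omega : 1 ≤ n + N)
    have h2 := hs.1.le
    have h3 := hs.2.le
    gcongr

lemma polyGrowth_expansionTail (hp : IsSmallFrom N p) {K : ℕ} {x : ℝ}
    (hx : 1 < d * x - b + K) : PolyGrowth (expansionTail d b N p q K) x := by
  obtain ⟨C, hC0, hC⟩ := exists_norm_expansionTail_term_le (d := d) (b := b) (q := q) hp K |x|
  refine .of_le (C := C * ∑' n : ℕ, ((n + N : ℕ) : ℝ) ^ (-(d * x - b + K))) (D := K)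
    fun s hs => ?_
  subst hs
  have h1 := (summable_nat_add_rpow_neg N hx).mul_left (C * (1 + ‖s‖) ^ K)
  refine (tsum_of_norm_bounded h1.hasSum (hC s le_rfl)).trans_eq ?_
  rw [tsum_mul_left]; ring

/-- The term of index `K` can be moved out of the remainder series because `q * p ^ K` is divisible
by `X ^ K`: its own series already converges in the same half-plane. -/
lemma expansion_succ (hp : IsSmallFrom N p) {K : ℕ} {s : ℂ} (hs : 1 < d * s.re - b + K) :
    expansion d b N p q (K + 1) s = expansion d b N p q K s := by
  have h1 : HasSum _ (polyZetaTail N (q * p ^ K) (d * s - b)) :=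
    hasSum_polyZetaTail hp.pos (K := K) (p := q * p ^ K) (z := d * s - b)
    (fun j hj => coeff_mul_pow_eq_zero hp.coeff_zero hj) (by simpa using hs)
  have h2 := (summable_expansionTail (q := q) (K := K + 1) hp (s := s) (d := d) (b := b)
    (by push_cast; linarith)).hasSum
  have h3 := h2.add (h1.mul_left (negBinom K s))
  have h4 : expansionTail d b N p q K s = expansionTail d b N p q (K + 1) s +
      negBinom K s * polyZetaTail N (q * p ^ K) (d * s - b) := by
    refine Eq.trans ?_ h3.tsum_eq
    refine tsum_congr fun n => ?_
    rw [binomRemainder_succ]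
    simp only [eval_mul, eval_pow]
    push_cast
    ring
  rw [expansion, expansion, h4, Finset.sum_range_succ]
  ring

lemma expansion_eq_of_le (hp : IsSmallFrom N p) {K K' : ℕ} {s : ℂ}
    (hs : 1 < d * s.re - b + K) (hK : K ≤ K') :
    expansion d b N p q K' s = expansion d b N p q K s := by
  induction K', hK using Nat.le_induction with
  | base => rfl
  | succ m hm ih =>
    rw [expansion_succ hp, ih]
    have : (K : ℝ) ≤ m := by exact_mod_cast hm
    linarith

lemma hasSum_expansion_zero (hp : IsSmallFrom N p) {s : ℂ} (hs : 1 < d * s.re - b) :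
    HasSum (fun n : ℕ => ((q.eval ((n + N : ℕ) : ℝ)⁻¹ : ℝ) : ℂ) *
      ((n + N : ℕ) : ℂ) ^ (-(d * s - b)) *
      ((1 + p.eval ((n + N : ℕ) : ℝ)⁻¹ : ℝ) : ℂ) ^ (-s)) (expansion d b N p q 0 s) := by
  have := (summable_expansionTail (q := q) (K := 0) hp (s := s) (d := d) (b := b)
    (by simpa using hs)).hasSum
  simpa [expansion, expansionTail, binomRemainder] using this

end Expansion

lemma analyticAt_zetaTail (N : ℕ) {z : ℂ} (hz : z ≠ 1) : AnalyticAt ℂ (zetaTail N) z :=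
  DifferentiableOn.analyticAt (s := {1}ᶜ)
    (fun _ hw => (differentiableAt_zetaTail N hw).differentiableWithinAt)
    (isOpen_compl_singleton.mem_nhds hz)

lemma analyticAt_polyZetaTail (N : ℕ) (p : ℝ[X]) {z : ℂ} (hz : ∀ j : ℕ, z + j ≠ 1) :
    AnalyticAt ℂ (polyZetaTail N p) z := by
  have : polyZetaTail N p = fun z => ∑ j ∈ Finset.range (p.natDegree + 1),
      (p.coeff j : ℂ) * zetaTail N (z + j) :=
    funext (polyZetaTail_eq_sum_range N (Nat.lt_succ_self _))
  rw [this]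
  refine Finset.analyticAt_fun_sum _ fun j _ => analyticAt_const.mul ?_
  exact (analyticAt_zetaTail N (hz j)).comp (f := fun z : ℂ => z + j)
    (analyticAt_id.add analyticAt_const)

lemma analyticAt_expansion {d b N : ℕ} {p q : ℝ[X]} (hp : IsSmallFrom N p) {K : ℕ} {s : ℂ}
    (hs : 1 < d * s.re - b + K) (hs' : ∀ j : ℕ, d * s - b + j ≠ 1) :
    AnalyticAt ℂ (expansion d b N p q K) s := by
  refine AnalyticAt.add (Finset.analyticAt_fun_sum _ fun k _ => ?_)
    (analyticAt_expansionTail hp hs)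
  refine ((differentiable_negBinom k).analyticAt s).mul ?_
  exact AnalyticAt.comp (f := fun s : ℂ => d * s - b)
    (analyticAt_polyZetaTail N (q * p ^ k) hs')
    ((analyticAt_const.mul analyticAt_id).sub analyticAt_const)

/-! ### Polynomial growth of zeta, from the shift `n ↦ n + 1` -/

lemma isSmallFrom_two_X : IsSmallFrom 2 (X : ℝ[X]) where
  pos := two_pos
  coeff_zero := by simp
  abs_le n hn := by
    have : (2 : ℝ) ≤ n := by exact_mod_cast hn
    rw [eval_X, abs_of_nonneg (by positivity), one_div]
    gcongr

/-- The binomial expansion of `∑_{n ≥ 2} n ^ (-w) (1 + 1 / n) ^ (-w)` is the shifted zeta series. -/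
lemma expansion_X_one_of_re {w : ℂ} (hw : 1 < w.re) (K : ℕ) :
    expansion 1 0 2 X 1 K w = zetaTail 3 w := by
  rw [expansion_eq_of_le isSmallFrom_two_X (K := 0) (by simpa using hw) (Nat.zero_le K)]
  have h := hasSum_expansion_zero (q := 1) (d := 1) (b := 0) isSmallFrom_two_X (s := w)
    (by simpa using hw)
  refine h.unique ?_
  convert! hasSum_zetaTail (N := 3) (by norm_num) hw using 2 with n
  simp only [eval_one, Complex.ofReal_one, one_mul, Nat.cast_one, Nat.cast_zero, sub_zero, eval_X]
  have h1 : ((n + 2 : ℕ) : ℂ) = (((n + 2 : ℕ) : ℝ) : ℂ) := by push_cast; rfl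
  have h2 : ((n + 3 : ℕ) : ℂ) = ((((n + 2 : ℕ) : ℝ) * (1 + ((n + 2 : ℕ) : ℝ)⁻¹) : ℝ) : ℂ) := by
    have h : (((n + 2 : ℕ) : ℝ) * (1 + ((n + 2 : ℕ) : ℝ)⁻¹) : ℝ) = (n + 3 : ℕ) := by
      have : ((n + 2 : ℕ) : ℝ) ≠ 0 := by positivity
      field_simp
      push_cast; ring
    rw [h]; push_cast; rfl
  rw [h1, h2, Complex.ofReal_mul, Complex.mul_cpow_ofReal_nonneg (by positivity) (by positivity)]

lemma expansion_X_one_of_im {w : ℂ} (hw : w.im ≠ 0) {K : ℕ} (hK : 1 < w.re + K) :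
    expansion 1 0 2 X 1 K w = zetaTail 3 w := by
  have hne : ∀ (c : ℝ) (j : ℕ), c ≠ 0 → ∀ z : ℂ, 0 < c * z.im → z + j ≠ 1 := by
    intro c j hc z hz h
    have := congrArg Complex.im h
    simp at this
    simp [this] at hz
  -- The sign of `c` selects the upper or lower half-plane. Its part with `Re z > 1 - K` is convex,
  -- avoids the real poles and meets `Re z > 1`, so the identity theorem applies.
  have key : ∀ c : ℝ, c ≠ 0 → 0 < c * w.im → expansion 1 0 2 X 1 K w = zetaTail 3 w := by
    intro c hc hcw
    set U : Set ℂ := {z | 1 - (K : ℝ) < z.re} ∩ {z | 0 < c * z.im}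
    have hUc : Convex ℝ U := by
      refine (convex_halfSpace_re_gt _).inter ?_
      exact convex_halfSpace_gt (f := fun z : ℂ => c * z.im)
        ⟨fun x y => by simp [mul_add], fun a x => by simp; ring⟩ 0
    have h1 : AnalyticOnNhd ℂ (expansion 1 0 2 X 1 K) U :=
      fun z hz => analyticAt_expansion isSmallFrom_two_X
        (by have := hz.1; simp at this ⊢; linarith) (fun j => by simpa using hne c j hc z hz.2)
    have h2 : AnalyticOnNhd ℂ (zetaTail 3) U :=
      fun z hz => analyticAt_zetaTail 3 (by simpa using hne c 0 hc z hz.2)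
    set z₀ : ℂ := 2 + w.im * Complex.I
    have hre : z₀.re = 2 := by simp [z₀]
    have him : z₀.im = w.im := by simp [z₀]
    have hz₀ : z₀ ∈ U := ⟨by simp [hre]; linarith [Nat.cast_nonneg (α := ℝ) K],
      by simpa [him] using hcw⟩
    refine h1.eqOn_of_preconnected_of_eventuallyEq h2 hUc.isPreconnected hz₀ ?_
      ⟨by simp; linarith, hcw⟩
    have : ∀ᶠ z : ℂ in 𝓝 z₀, 1 < z.re :=
      (isOpen_lt continuous_const Complex.continuous_re).mem_nhds (by simp [hre])
    filter_upwards [this] with z hz using expansion_X_one_of_re hz K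
  exact key w.im hw (mul_self_pos.2 hw)

/-- The term `k = 0` of the expansion cancels the zeta tail at `w`, up to `2 ^ (-w)`, and the term
`k = 1` is `-w * zetaTail 2 (w + 1)`. So the value at `w + 1` is expressed by values at `w + 2` and
further right. -/
lemma mul_zetaTail_two_add_one {w : ℂ} (hw : w.im ≠ 0) {K : ℕ} (hK : 1 < w.re + (K + 2 : ℕ)) :
    w * zetaTail 2 (w + 1) = (2 : ℂ) ^ (-w) +
      ∑ k ∈ Finset.range K, negBinom (k + 2) w * zetaTail 2 (w + (k + 2 : ℕ)) +
      expansionTail 1 0 2 X 1 (K + 2) w := by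
  have h := expansion_X_one_of_im hw hK
  have h1 : ∀ k : ℕ, polyZetaTail 2 (X ^ k : ℝ[X]) w = zetaTail 2 (w + k) := by
    intro k
    rw [polyZetaTail, ← monomial_one_right_eq_X_pow, sum_monomial_index] <;> simp
  have h2 : zetaTail 2 w = zetaTail 3 w + (2 : ℂ) ^ (-w) := by
    simp [zetaTail, show Finset.Ico 1 2 = {1} from rfl, show Finset.Ico 1 3 = {1, 2} from rfl]
    ring
  rw [expansion, Finset.sum_range_succ', Finset.sum_range_succ'] at h
  simp only [Nat.cast_one, one_mul, Nat.cast_zero, sub_zero, h1] at h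
  rw [negBinom_one, negBinom] at h
  simp only [add_zero, zero_add, Nat.cast_one, one_mul, h2] at h
  simp only [add_assoc, one_add_one_eq_two] at h
  linear_combination -h

lemma polyGrowth_inv (x : ℝ) : PolyGrowth (fun s => s⁻¹) x := by
  refine ⟨0, Asymptotics.IsBigO.of_bound 1 ?_⟩
  filter_upwards [tendsto_abs_atTop_sup_atBot.eventually_ge_atTop 1] with y hy
  have := Complex.abs_im_le_norm ((x : ℂ) + (y : ℂ) * Complex.I)
  simp only [Complex.add_im, Complex.ofReal_im, Complex.mul_im, Complex.ofReal_re, Complex.I_im,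
    mul_one, Complex.I_re, mul_zero, add_zero, zero_add] at this
  rw [norm_inv]
  simpa using inv_le_one_of_one_le₀ (hy.trans this)

lemma eventually_im_ne_zero (x : ℝ) :
    ∀ᶠ y : ℝ in atTop ⊔ atBot, ((x : ℂ) + (y : ℂ) * Complex.I).im ≠ 0 := by
  filter_upwards [tendsto_abs_atTop_sup_atBot.eventually_ge_atTop 1] with y hy
  have : y ≠ 0 := by rintro rfl; simp at hy; linarith
  simpa using this

lemma polyGrowth_zetaTail_two (x : ℝ) : PolyGrowth (zetaTail 2) x := by
  have key : ∀ m : ℕ, ∀ x : ℝ, 1 - (m : ℝ) < x → PolyGrowth (zetaTail 2) x := by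
    intro m
    induction m with
    | zero =>
      intro x hx
      refine .of_le (C := ∑' n : ℕ, ((n + 2 : ℕ) : ℝ) ^ (-x)) (D := 0) fun s hs => ?_
      have h1 := hasSum_zetaTail (N := 2) two_pos (z := s) (by rw [hs]; simpa using hx)
      rw [pow_zero, mul_one, ← h1.tsum_eq]
      refine tsum_of_norm_bounded (summable_nat_add_rpow_neg 2 (by simpa using hx)).hasSum
        fun n => ?_
      rw [Complex.norm_natCast_cpow_of_pos (by omega), Complex.neg_re, hs]
    | succ m ih =>
      intro x hx
      push_cast at hx
      -- The identity is used on the line `Re w = x - 1`: the zeta values on the right then lie on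
      -- lines `x + 1 + k`, covered by induction.
      have h1 : PolyGrowth (fun w => (2 : ℂ) ^ (-w) +
          ∑ k ∈ Finset.range m, negBinom (k + 2) w * zetaTail 2 (w + (k + 2 : ℕ)) +
          expansionTail 1 0 2 X 1 (m + 2) w) (x - 1) := by
        refine ((polyGrowth_ofReal_cpow_neg two_pos _).add (.sum fun k _ => ?_)).add
          (polyGrowth_expansionTail isSmallFrom_two_X (by push_cast; linarith))
        refine (polyGrowth_negBinom _ _).mul ?_
        have := PolyGrowth.comp_add_ofReal (x := x - 1) (c := (k + 2 : ℕ)) (ih _ (by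
          push_cast; linarith [Nat.cast_nonneg (α := ℝ) k]))
        simpa only [Complex.ofReal_natCast] using this
      have h2 : PolyGrowth (fun w => zetaTail 2 (w + 1)) (x - 1) := by
        refine ((polyGrowth_inv _).mul h1).congr' ?_
        filter_upwards [eventually_im_ne_zero (x - 1)] with y hy
        rw [← mul_zetaTail_two_add_one hy (by simp; linarith), inv_mul_cancel_left₀]
        intro h0
        exact hy (by rw [h0]; simp)
      have h3 := PolyGrowth.comp_add_ofReal (x := x) (c := -1) (by simpa [sub_eq_add_neg] using h2)
      simpa using h3
  obtain ⟨m, hm⟩ := exists_nat_gt (1 - x)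
  exact key m x (by linarith)

lemma polyGrowth_zetaTail (N : ℕ) (x : ℝ) : PolyGrowth (zetaTail N) x := by
  have h : zetaTail N = fun s => zetaTail 2 s + ((1 : ℝ) : ℂ) ^ (-s) -
      ∑ n ∈ Finset.Ico 1 N, ((n : ℝ) : ℂ) ^ (-s) := by
    ext s; simp [zetaTail]
  rw [h]
  refine ((polyGrowth_zetaTail_two x).add (polyGrowth_ofReal_cpow_neg one_pos x)).sub
    (.sum fun n hn => polyGrowth_ofReal_cpow_neg ?_ x)
  exact_mod_cast (Finset.mem_Ico.1 hn).1

lemma polyGrowth_polyZetaTail (N : ℕ) (p : ℝ[X]) (x : ℝ) : PolyGrowth (polyZetaTail N p) x := by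
  have : polyZetaTail N p = fun z => ∑ j ∈ Finset.range (p.natDegree + 1),
      (p.coeff j : ℂ) * zetaTail N (z + (j : ℝ)) := by
    ext z
    simpa using polyZetaTail_eq_sum_range N (Nat.lt_succ_self p.natDegree) z
  rw [this]
  exact .sum fun j _ => (PolyGrowth.const _).mul (polyGrowth_zetaTail N _).comp_add_ofReal

lemma polyGrowth_expansion {d b N : ℕ} {p q : ℝ[X]} (hd : d ≠ 0) (hp : IsSmallFrom N p) {K : ℕ}
    {x : ℝ} (hx : 1 < d * x - b + K) : PolyGrowth (expansion d b N p q K) x := by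
  refine (PolyGrowth.sum fun k _ => (polyGrowth_negBinom k x).mul ?_).add
    (polyGrowth_expansionTail hp hx)
  have := PolyGrowth.comp_natCast_mul (x := x) hd
    (PolyGrowth.comp_add_ofReal (c := -b) (polyGrowth_polyZetaTail N (q * p ^ k) _))
  simpa [sub_eq_add_neg] using this

/-! ### Orders, poles and continuation to the plane -/

/-- `f` is meromorphic at `z` of order at least `n`. -/
def OrderGE (n : ℤ) (f : ℂ → ℂ) (z : ℂ) : Prop :=
  MeromorphicAt f z ∧ (n : WithTop ℤ) ≤ meromorphicOrderAt f z

namespace OrderGE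

variable {f g : ℂ → ℂ} {m n : ℤ} {z : ℂ}

lemma congr (hf : OrderGE n f z) (h : f =ᶠ[𝓝[≠] z] g) : OrderGE n g z :=
  ⟨hf.1.congr h, hf.2.trans_eq (meromorphicOrderAt_congr h)⟩

lemma mono (hf : OrderGE n f z) (h : m ≤ n) : OrderGE m f z :=
  ⟨hf.1, (WithTop.coe_le_coe.2 h).trans hf.2⟩

lemma add (hf : OrderGE n f z) (hg : OrderGE n g z) : OrderGE n (fun s => f s + g s) z :=
  ⟨hf.1.add hg.1, (le_min hf.2 hg.2).trans (meromorphicOrderAt_add hf.1 hg.1)⟩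

lemma mul (hf : OrderGE n f z) (hg : OrderGE m g z) : OrderGE (n + m) (fun s => f s * g s) z := by
  refine ⟨hf.1.mul hg.1, ?_⟩
  have h : meromorphicOrderAt (fun s => f s * g s) z = _ := meromorphicOrderAt_mul hf.1 hg.1
  rw [h, WithTop.coe_add]
  exact add_le_add hf.2 hg.2

lemma of_analyticAt (hf : AnalyticAt ℂ f z) : OrderGE 0 f z :=
  ⟨hf.meromorphicAt, hf.meromorphicOrderAt_nonneg⟩

lemma of_analyticAt_of_eq_zero (hf : AnalyticAt ℂ f z) (h : f z = 0) : OrderGE 1 f z := by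
  refine ⟨hf.meromorphicAt, ?_⟩
  have h1 : 0 < meromorphicOrderAt f z := by
    rw [← tendsto_zero_iff_meromorphicOrderAt_pos hf.meromorphicAt, ← h]
    exact hf.continuousAt.tendsto.mono_left nhdsWithin_le_nhds
  generalize meromorphicOrderAt f z = o at h1
  induction o using WithTop.recTopCoe with
  | top => exact le_top
  | coe a => exact WithTop.coe_le_coe.2 (Int.add_one_le_of_lt (WithTop.coe_lt_coe.1 h1))

lemma sum {ι : Type*} {t : Finset ι} {F : ι → ℂ → ℂ} (h : ∀ i ∈ t, OrderGE n (F i) z)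
    (hn : n ≤ 0) : OrderGE n (fun s => ∑ i ∈ t, F i s) z := by
  classical
  induction t using Finset.induction_on with
  | empty => simpa using (of_analyticAt (z := z) (analyticAt_const (v := (0 : ℂ)))).mono hn
  | insert i t hi ih =>
    simp only [Finset.sum_insert hi]
    exact (h i (by simp)).add (ih fun j hj => h j (by simp [hj]))

lemma inv_sub (z : ℂ) : OrderGE (-1) (fun s => (s - z)⁻¹) z := by
  refine ⟨by fun_prop, ?_⟩
  have : (fun s : ℂ => (s - z)⁻¹) = (fun s => s - z)⁻¹ := rfl
  rw [this, meromorphicOrderAt_inv, meromorphicOrderAt_id_sub_const]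
  exact le_rfl

end OrderGE

lemma orderGE_zetaTail (N : ℕ) : OrderGE (-1) (zetaTail N) 1 := by
  have h1 : OrderGE (-1) riemannZeta 1 := by
    refine ((OrderGE.inv_sub 1).mul
      (.of_analyticAt (differentiable_riemannZeta₁.analyticAt 1))).congr ?_
    filter_upwards [self_mem_nhdsWithin] with s hs using (riemannZeta_eq_inv_sub_mul hs).symm
  have h2 : AnalyticAt ℂ (fun z : ℂ => -∑ n ∈ Finset.Ico 1 N, (n : ℂ) ^ (-z)) 1 := by
    refine (Finset.analyticAt_fun_sum _ fun n hn => ?_).neg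
    have : (n : ℂ) ≠ 0 := by
      have := (Finset.mem_Ico.1 hn).1
      exact_mod_cast (by omega : n ≠ 0)
    exact (differentiable_id.neg.const_cpow (Or.inl this)).analyticAt 1
  simpa only [← sub_eq_add_neg] using! h1.add ((OrderGE.of_analyticAt h2).mono (by simp))

lemma orderGE_zetaTail_comp (N : ℕ) {d : ℕ} (hd : d ≠ 0) {c s₀ : ℂ} (h : d * s₀ + c = 1) :
    OrderGE (-1) (fun s => zetaTail N (d * s + c)) s₀ := by
  have hg : AnalyticAt ℂ (fun s : ℂ => d * s + c) s₀ :=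
    (analyticAt_const.mul analyticAt_id).add analyticAt_const
  have hd' : deriv (fun s : ℂ => d * s + c) s₀ ≠ 0 := by
    simpa [deriv_const_mul_id'] using hd
  have h1 := orderGE_zetaTail N
  rw [← h] at h1
  refine ⟨MeromorphicAt.comp_analyticAt (g := fun s : ℂ => d * s + c) h1.1 hg, ?_⟩
  have := meromorphicOrderAt_comp_of_deriv_ne_zero (f := zetaTail N) hg hd'
  rw [Function.comp_def] at this
  rw [this]
  exact h1.2

section Expansion

variable {d b N : ℕ} {p q : ℝ[X]}

/-- The coefficient of `n ^ (-(d * s - b + j))` in the expansion with `K` terms. -/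
noncomputable def expansionCoeff (p q : ℝ[X]) (K j : ℕ) (s : ℂ) : ℂ :=
  ∑ k ∈ Finset.range K, negBinom k s * ((q * p ^ k).coeff j : ℂ)

lemma differentiable_expansionCoeff (p q : ℝ[X]) (K j : ℕ) :
    Differentiable ℂ (expansionCoeff p q K j) :=
  Differentiable.fun_sum fun k _ => (differentiable_negBinom k).mul_const _

/-- Grouping by powers of `n` gathers everything that multiplies a given zeta tail into one entire
coefficient, whose zeros can cancel the pole. -/
lemma expansion_eq_sum_coeff (K : ℕ) : ∃ J : ℕ, ∀ s : ℂ, expansion d b N p q K s =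
    ∑ j ∈ Finset.range J, expansionCoeff p q K j s * zetaTail N (d * s + (j - b)) +
      expansionTail d b N p q K s := by
  refine ⟨(Finset.range K).sup (fun k => (q * p ^ k).natDegree) + 1, fun s => ?_⟩
  rw [expansion]
  simp only [expansionCoeff, Finset.sum_mul]
  rw [Finset.sum_comm]
  congr 1
  refine Finset.sum_congr rfl fun k hk => ?_
  rw [polyZetaTail_eq_sum_range N (Nat.lt_succ_of_le
    (Finset.le_sup (f := fun k => (q * p ^ k).natDegree) hk)), Finset.mul_sum]
  refine Finset.sum_congr rfl fun j _ => ?_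
  rw [mul_assoc]
  congr 3
  ring

/-- At `s = -m` the coefficient is that of `q * (1 + p) ^ m`, a polynomial of degree at most `b + d
* m`. -/
lemma expansionCoeff_neg_natCast {K m j : ℕ} (hK : m < K) (hp : p.natDegree ≤ d)
    (hq : q.natDegree ≤ b) (hj : b + d * m < j) : expansionCoeff p q K j (-(m : ℂ)) = 0 := by
  have h1 : ((q * (p + 1) ^ m).coeff j : ℂ) = expansionCoeff p q K j (-(m : ℂ)) := by
    rw [add_pow, Finset.mul_sum, finsetSum_coeff, Complex.ofReal_sum, expansionCoeff]
    rw [← Finset.sum_subset (Finset.range_subset_range.2 (Nat.succ_le_of_lt hK))]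
    · refine Finset.sum_congr rfl fun k _ => ?_
      rw [negBinom_neg_natCast, one_pow, mul_one, ← mul_assoc, ← C_eq_natCast, coeff_mul_C]
      push_cast; ring
    · intro k _ hk
      rw [negBinom_neg_natCast, Nat.choose_eq_zero_of_lt (by simpa using hk)]
      simp
  have h2 : (q * (p + 1) ^ m).natDegree ≤ b + d * m := by
    refine natDegree_mul_le.trans (add_le_add hq (natDegree_pow_le.trans ?_))
    rw [mul_comm]
    gcongr
    exact (natDegree_add_le _ _).trans (by simpa using hp)
  rw [← h1, coeff_eq_zero_of_natDegree_lt (h2.trans_lt hj), Complex.ofReal_zero]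

variable (d b N p q) in
/-- The continuation of `∑_{n ≥ N} q (1 / n) n ^ b (n ^ d (1 + p (1 / n))) ^ (-s)` to the plane. -/
noncomputable def continuedExpansion (s : ℂ) : ℂ :=
  -- This `K` gives `Re (d * s - b) + K ≥ 2`; any `K` making this quantity exceed `1` gives the same
  -- value.
  expansion d b N p q ⌈b + 2 - d * s.re⌉₊ s

lemma continuedExpansion_eq (hp : IsSmallFrom N p) {K : ℕ} {s : ℂ}
    (hs : 1 < d * s.re - b + K) : continuedExpansion d b N p q s = expansion d b N p q K s := by
  have h1 := Nat.le_ceil (b + 2 - d * s.re)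
  rcases le_total ⌈b + 2 - d * s.re⌉₊ K with h | h
  · exact (expansion_eq_of_le hp (by linarith) h).symm
  · exact expansion_eq_of_le hp hs h

lemma continuedExpansion_eventuallyEq (hp : IsSmallFrom N p) {K : ℕ} {s : ℂ}
    (hs : 1 < d * s.re - b + K) :
    continuedExpansion d b N p q =ᶠ[𝓝 s] expansion d b N p q K := by
  have : IsOpen {s : ℂ | 1 < d * s.re - b + K} := isOpen_lt continuous_const
    (((continuous_const.mul Complex.continuous_re).sub continuous_const).add continuous_const)
  filter_upwards [this.mem_nhds hs] with z hz using continuedExpansion_eq hp hz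

lemma exists_nat_one_lt_add (x : ℝ) (m : ℕ) : ∃ K : ℕ, m < K ∧ 1 < x + K := by
  obtain ⟨K, hK⟩ := exists_nat_gt (max (m : ℝ) (1 - x))
  exact ⟨K, by exact_mod_cast (le_max_left _ _).trans_lt hK,
    by linarith [(le_max_right (m : ℝ) (1 - x)).trans_lt hK]⟩

lemma analyticAt_continuedExpansion (hp : IsSmallFrom N p) {s : ℂ}
    (hs : ∀ j : ℕ, d * s - b + j ≠ 1) : AnalyticAt ℂ (continuedExpansion d b N p q) s := by
  obtain ⟨K, -, hK⟩ := exists_nat_one_lt_add (d * s.re - b) 0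
  exact (analyticAt_expansion hp hK hs).congr (continuedExpansion_eventuallyEq hp hK).symm

/-- Only the terms whose zeta argument equals `1` at the point can be singular there. -/
lemma orderGE_continuedExpansion_of_forall {n : ℤ} (hn : n ≤ 0) (hp : IsSmallFrom N p) {s : ℂ}
    {K : ℕ} (hK : 1 < d * s.re - b + K)
    (h : ∀ j : ℕ, d * s + (j - b) = 1 →
      OrderGE n (fun s => expansionCoeff p q K j s * zetaTail N (d * s + (j - b))) s) :
    OrderGE n (continuedExpansion d b N p q) s := by
  obtain ⟨J, hJ⟩ := expansion_eq_sum_coeff (d := d) (b := b) (N := N) (p := p) (q := q) K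
  refine OrderGE.congr (f := expansion d b N p q K) ?_
    ((continuedExpansion_eventuallyEq hp hK).symm.filter_mono nhdsWithin_le_nhds)
  rw [funext hJ]
  refine (OrderGE.sum (fun j _ => ?_) hn).add
    ((OrderGE.of_analyticAt (analyticAt_expansionTail hp hK)).mono hn)
  by_cases hj : d * s + (j - b) = 1
  · exact h j hj
  · refine (OrderGE.of_analyticAt (((differentiable_expansionCoeff p q K j).analyticAt s).mul
      ?_)).mono hn
    exact (analyticAt_zetaTail N hj).comp (f := fun s : ℂ => d * s + (j - b))
      ((analyticAt_const.mul analyticAt_id).add analyticAt_const)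

lemma orderGE_neg_one_continuedExpansion (hd : d ≠ 0) (hp : IsSmallFrom N p) (s : ℂ) :
    OrderGE (-1) (continuedExpansion d b N p q) s := by
  obtain ⟨K, -, hK⟩ := exists_nat_one_lt_add (d * s.re - b) 0
  refine orderGE_continuedExpansion_of_forall (by simp) hp hK fun j hj => ?_
  simpa using (OrderGE.of_analyticAt ((differentiable_expansionCoeff p q K j).analyticAt s)).mul
    (orderGE_zetaTail_comp N hd hj)

lemma orderGE_zero_continuedExpansion_neg_natCast (hd : d ≠ 0) (hp : IsSmallFrom N p)
    (hpd : p.natDegree ≤ d) (hq : q.natDegree ≤ b) (m : ℕ) :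
    OrderGE 0 (continuedExpansion d b N p q) (-(m : ℂ)) := by
  obtain ⟨K, hmK, hK⟩ := exists_nat_one_lt_add (d * (-(m : ℂ)).re - b) m
  refine orderGE_continuedExpansion_of_forall le_rfl hp hK fun j hj => ?_
  -- The singular index is exactly one beyond the degree bound, so its coefficient has a zero
  -- against the simple pole.
  have hj' : j = 1 + b + d * m := by
    have : (j : ℂ) = (1 + b + d * m : ℕ) := by push_cast; linear_combination hj
    exact_mod_cast this
  simpa using (OrderGE.of_analyticAt_of_eq_zero
    ((differentiable_expansionCoeff p q K j).analyticAt _)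
    (expansionCoeff_neg_natCast hmK hpd hq (by omega))).mul (orderGE_zetaTail_comp N hd hj)

lemma polyGrowth_continuedExpansion (hd : d ≠ 0) (hp : IsSmallFrom N p) (x : ℝ) :
    PolyGrowth (continuedExpansion d b N p q) x := by
  obtain ⟨K, -, hK⟩ := exists_nat_one_lt_add (d * x - b) 0
  refine (polyGrowth_expansion (q := q) hd hp hK).congr' (Eventually.of_forall fun y => ?_)
  exact (continuedExpansion_eq hp (by simpa using hK)).symm

end Expansion

lemma toMeromorphicNFOn_univ_apply_of_analyticAt {F : ℂ → ℂ} (hF : MeromorphicOn F Set.univ)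
    {z : ℂ} (hz : AnalyticAt ℂ F z) : toMeromorphicNFOn F Set.univ z = F z := by
  rw [toMeromorphicNFOn_eq_toMeromorphicNFAt hF (Set.mem_univ z),
    toMeromorphicNFAt_eq_self.2 hz.meromorphicNFAt]

/-! ### Divergence of the Dirichlet series -/

lemma one_half_le_re_exp {z : ℂ} (hz : ‖z‖ ≤ 1 / 4) : 1 / 2 ≤ (Complex.exp z).re := by
  have h1 := Complex.norm_exp_sub_one_le (x := z) (by linarith)
  have h2 := (Complex.abs_re_le_norm _).trans h1
  rw [Complex.sub_re, Complex.one_re] at h2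
  linarith [(abs_le.1 h2).1]

/-- A Dirichlet series with exponents `d * log n + κ + o(1)` and nonnegative coefficients bounded
below by a multiple of `n ^ b` diverges for `d * Re s ≤ 1 + b`. -/
lemma not_dirichletConverges {M : ℕ → ℕ} {ℓ : ℕ → ℝ} {d b : ℕ} {β κ : ℝ} (hβ : 0 < β)
    (hM : ∀ᶠ n : ℕ in atTop, β * (n : ℝ) ^ b ≤ M n)
    (hℓ : Tendsto (fun n : ℕ => ℓ n - d * Real.log n) atTop (𝓝 κ)) {s : ℂ}
    (hs : d * s.re ≤ 1 + b) : ¬ DirichletConverges (fun n => (M n : ℂ)) ℓ s := by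
  rintro ⟨l, hl⟩
  -- `η` and `Q` are chosen so that on a block `[Q m, (Q + 1) m)`, where `log n` varies by at most
  -- `1 / Q`, the phase `‖s‖ * |ℓ n - ℓ k|` is at most `1 / 8 + 1 / 8`.
  set η : ℝ := 1 / (16 * (‖s‖ + 1)) with hη
  have hs1 : 0 < ‖s‖ + 1 := by positivity
  have hη0 : 0 < η := by positivity
  obtain ⟨Q, hQ⟩ := exists_nat_gt (8 * d * (‖s‖ + 1))
  have hQ0 : (0 : ℝ) < Q := lt_of_le_of_lt (by positivity) hQ
  have hQ1 : 0 < Q := by exact_mod_cast hQ0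
  have hℓ' : ∀ᶠ n : ℕ in atTop, |ℓ n - d * Real.log n - κ| < η := by
    simpa only [Real.dist_eq] using (Metric.tendsto_nhds.1 hℓ) η hη0
  obtain ⟨n₀, hn₀⟩ := eventually_atTop.1 (hM.and hℓ')
  set c : ℝ := Real.exp (-(|s.re| * (|κ| + η)))
  have hc : 0 < c := Real.exp_pos _
  have ht : Tendsto (fun m : ℕ => Q * m) atTop atTop := tendsto_id.const_mul_atTop' hQ1
  have ht' : Tendsto (fun m : ℕ => (Q + 1) * m) atTop atTop :=
    tendsto_id.const_mul_atTop' Q.succ_pos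
  -- Convergence forces the block sums to `0`. But a block starting at `k = Q m` has `k / Q` terms,
  -- each of size at least a constant times `k ^ (b - d * Re s) ≥ 1 / k`.
  have hlim : Tendsto (fun m : ℕ => ‖∑ n ∈ Finset.Ico (Q * m) ((Q + 1) * m),
      (M n : ℂ) * Complex.exp (-s * ℓ n)‖) atTop (𝓝 0) := by
    have := ((hl.comp ht').sub (hl.comp ht)).norm
    simp only [sub_self, norm_zero] at this
    refine this.congr fun m => ?_
    rw [Finset.sum_Ico_eq_sub _ (by gcongr; omega)]
    rfl
  have hpos : 0 < c * β / (4 * Q) := by positivity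
  obtain ⟨m, hm1, hm2⟩ := ((hlim.eventually (gt_mem_nhds hpos)).and
    (eventually_ge_atTop (n₀ + 1))).exists
  refine absurd hm1 (not_lt.2 ?_)
  have hm0 : (0 : ℝ) < m := by exact_mod_cast (by omega : 0 < m)
  have hk0 : (0 : ℝ) < ((Q * m : ℕ) : ℝ) := by push_cast; positivity
  have hkm : m ≤ Q * m := Nat.le_mul_of_pos_left m hQ1
  set k := Q * m with hk
  have hk2 := (hn₀ k (by omega)).2
  have hterm : ∀ n ∈ Finset.Ico k ((Q + 1) * m), β * (k : ℝ) ^ b / 2 ≤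
      ((M n : ℂ) * Complex.exp (-s * (ℓ n - ℓ k : ℝ))).re := by
    intro n hn
    obtain ⟨hn1, hn2⟩ := Finset.mem_Ico.1 hn
    obtain ⟨h1, h2⟩ := hn₀ n (by omega)
    have hkn : (k : ℝ) ≤ n := by exact_mod_cast hn1
    have hlog : 0 ≤ Real.log n - Real.log k ∧ Real.log n - Real.log k ≤ 1 / Q := by
      refine ⟨sub_nonneg.2 (Real.log_le_log hk0 hkn), ?_⟩
      rw [← Real.log_div (by linarith) hk0.ne']
      refine (Real.log_le_sub_one_of_pos (div_pos (by linarith) hk0)).trans ?_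
      have h3 : (n : ℝ) ≤ (Q + 1) * m := by exact_mod_cast hn2.le
      have h4 : (k : ℝ) = Q * m := by rw [hk]; push_cast; rfl
      rw [sub_le_iff_le_add, div_le_iff₀ hk0]
      refine h3.trans_eq ?_
      rw [h4]; field_simp; ring
    have hdiff : |ℓ n - ℓ k| ≤ 2 * η + d * (1 / Q) := by
      have h5 : (d : ℝ) * (Real.log n - Real.log k) ≤ d * (1 / Q) := by gcongr; exact hlog.2
      have h6 : 0 ≤ (d : ℝ) * (Real.log n - Real.log k) := mul_nonneg (by positivity) hlog.1
      rw [abs_lt] at h2 hk2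
      rw [abs_le]
      constructor <;> nlinarith
    have hz : ‖-s * (ℓ n - ℓ k : ℝ)‖ ≤ 1 / 4 := by
      rw [norm_mul, norm_neg, Complex.norm_real, Real.norm_eq_abs]
      calc ‖s‖ * |ℓ n - ℓ k| ≤ (‖s‖ + 1) * (2 * η + d * (1 / Q)) := by gcongr; linarith
        _ = 1 / 8 + d * (‖s‖ + 1) / Q := by rw [hη]; field_simp; ring
        _ ≤ 1 / 8 + 1 / 8 := by
          refine add_le_add_right ?_ _
          rw [div_le_iff₀ hQ0]; linarith
        _ = 1 / 4 := by norm_num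
    have h7 := one_half_le_re_exp hz
    rw [← Complex.ofReal_natCast, Complex.re_ofReal_mul]
    calc β * (k : ℝ) ^ b / 2 = (β * (k : ℝ) ^ b) * (1 / 2) := by ring
      _ ≤ (β * (n : ℝ) ^ b) * (1 / 2) := by gcongr
      _ ≤ M n * (1 / 2) := by gcongr
      _ ≤ _ := by gcongr
  have hsum : (m : ℝ) * (β * (k : ℝ) ^ b / 2) ≤ ‖∑ n ∈ Finset.Ico k ((Q + 1) * m),
      (M n : ℂ) * Complex.exp (-s * (ℓ n - ℓ k : ℝ))‖ := by
    refine le_trans ?_ (Complex.re_le_norm _)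
    rw [Complex.re_sum]
    have := Finset.card_nsmul_le_sum _ _ _ hterm
    rw [Nat.card_Ico, nsmul_eq_mul] at this
    convert this using 2
    rw [hk, add_mul, one_mul, Nat.add_sub_cancel_left]
  -- Without the common factor `exp (-s * ℓ k)` all terms of the block have nearly the same phase
  -- and cannot cancel.
  have hfac : ∑ n ∈ Finset.Ico k ((Q + 1) * m), (M n : ℂ) * Complex.exp (-s * ℓ n) =
      Complex.exp (-s * ℓ k) * ∑ n ∈ Finset.Ico k ((Q + 1) * m),
        (M n : ℂ) * Complex.exp (-s * (ℓ n - ℓ k : ℝ)) := by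
    rw [Finset.mul_sum]
    refine Finset.sum_congr rfl fun n _ => ?_
    rw [mul_left_comm, ← Complex.exp_add]
    congr 2
    push_cast; ring
  have hexp : c * (k : ℝ) ^ (-(d * s.re)) ≤ ‖Complex.exp (-s * ℓ k)‖ := by
    rw [Complex.norm_exp, Real.rpow_def_of_pos hk0, ← Real.exp_add]
    refine Real.exp_le_exp.2 ?_
    have h1 : (-s * (ℓ k : ℂ)).re = -s.re * ℓ k := by simp
    rw [h1]
    have h2 : |ℓ k - d * Real.log k| ≤ |κ| + η := by
      have := abs_add_le (ℓ k - d * Real.log k - κ) κ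
      rw [sub_add_cancel] at this
      linarith
    have h3 : |s.re * (ℓ k - d * Real.log k)| ≤ |s.re| * (|κ| + η) := by
      rw [abs_mul]; gcongr
    linarith [(abs_le.1 h3).2]
  have hpow : 1 / (Q * m) ≤ (k : ℝ) ^ (-(d * s.re)) * (k : ℝ) ^ b := by
    have hk1 : (1 : ℝ) ≤ k := by exact_mod_cast (by omega : 1 ≤ k)
    rw [← Real.rpow_natCast (k : ℝ) b, ← Real.rpow_add hk0]
    calc (1 : ℝ) / (Q * m) = (k : ℝ) ^ (-1 : ℝ) := by
          rw [Real.rpow_neg_one, hk]; push_cast; rw [one_div]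
      _ ≤ _ := Real.rpow_le_rpow_of_exponent_le hk1 (by linarith)
  rw [hfac, norm_mul]
  calc c * β / (4 * Q) ≤ c * β / (2 * Q) := by gcongr; norm_num
    _ = (c * (m * (β / 2))) * (1 / (Q * m)) := by field_simp
    _ ≤ (c * (m * (β / 2))) * ((k : ℝ) ^ (-(d * s.re)) * (k : ℝ) ^ b) := by gcongr
    _ = (c * (k : ℝ) ^ (-(d * s.re))) * (m * (β * (k : ℝ) ^ b / 2)) := by ring
    _ ≤ _ := by gcongr

/-! ### The series of the polynomials `A` and `B` -/

lemma eval_natCast_eq_pow_mul_reverse (A : ℝ[X]) {n : ℕ} (hn : n ≠ 0) :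
    A.eval (n : ℝ) = (n : ℝ) ^ A.natDegree * A.reverse.eval (n : ℝ)⁻¹ := by
  have hn' : (n : ℝ) ≠ 0 := by exact_mod_cast hn
  let _ := invertibleOfNonzero hn'
  have := eval₂_reverse_mul_pow (RingHom.id ℝ) (n : ℝ) A
  rw [invOf_eq_inv] at this
  simp only [eval₂_id] at this
  rw [← this, mul_comm]

/-- The polynomial `p` with `A n = a n ^ d (1 + p (1 / n))`, `a` the leading coefficient and `d` the
degree of `A`. -/
noncomputable def lowerOrderPart (A : ℝ[X]) : ℝ[X] := C A.leadingCoeff⁻¹ * A.reverse - 1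

lemma natDegree_lowerOrderPart_le (A : ℝ[X]) : (lowerOrderPart A).natDegree ≤ A.natDegree := by
  refine (natDegree_sub_le _ _).trans ?_
  simpa using (natDegree_C_mul_le _ _).trans (reverse_natDegree_le A)

lemma lowerOrderPart_coeff_zero {A : ℝ[X]} (hA : A ≠ 0) : (lowerOrderPart A).coeff 0 = 0 := by
  rw [lowerOrderPart, coeff_sub, coeff_C_mul, coeff_zero_reverse, coeff_one_zero,
    inv_mul_cancel₀ (leadingCoeff_ne_zero.2 hA), sub_self]

lemma eval_natCast_eq_lowerOrderPart {A : ℝ[X]} (hA : A ≠ 0) {n : ℕ} (hn : n ≠ 0) :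
    A.eval (n : ℝ) =
      A.leadingCoeff * ((n : ℝ) ^ A.natDegree * (1 + (lowerOrderPart A).eval (n : ℝ)⁻¹)) := by
  rw [eval_natCast_eq_pow_mul_reverse A hn, lowerOrderPart]
  simp only [eval_sub, eval_mul, eval_C, eval_one]
  have := leadingCoeff_ne_zero.2 hA
  field_simp
  ring

lemma natCast_pow_cpow (n d : ℕ) (w : ℂ) : (((n : ℝ) ^ d : ℝ) : ℂ) ^ w = ((n : ℂ) ^ w) ^ d := by
  induction d with
  | zero => simp
  | succ d ih =>
    rw [pow_succ, Complex.ofReal_mul, Complex.mul_cpow_ofReal_nonneg (by positivity)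
      (by positivity), ih, pow_succ, Complex.ofReal_natCast]

section Spectrum

variable {A B : ℝ[X]} {lam : ℕ → ℝ} {M : ℕ → ℕ}

lemma tendsto_eval_inv (p : ℝ[X]) :
    Tendsto (fun n : ℕ => p.eval (n : ℝ)⁻¹) atTop (𝓝 (p.coeff 0)) := by
  rw [coeff_zero_eq_eval_zero]
  exact (p.continuous.tendsto 0).comp tendsto_inv_atTop_nhds_zero_nat

lemma tendsto_log_eval_sub (hA0 : 0 < A.leadingCoeff) :
    Tendsto (fun n : ℕ => Real.log (A.eval (n : ℝ)) - A.natDegree * Real.log n) atTop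
      (𝓝 (Real.log A.leadingCoeff)) := by
  have h1 : Tendsto (fun n : ℕ => Real.log (A.reverse.eval (n : ℝ)⁻¹)) atTop
      (𝓝 (Real.log A.leadingCoeff)) := by
    rw [← coeff_zero_reverse] at hA0 ⊢
    exact (tendsto_eval_inv A.reverse).log hA0.ne'
  have h2 : ∀ᶠ n : ℕ in atTop, A.reverse.eval (n : ℝ)⁻¹ ≠ 0 :=
    (tendsto_eval_inv A.reverse).eventually_ne (by rw [coeff_zero_reverse]; exact hA0.ne')
  refine h1.congr' ?_
  filter_upwards [h2, eventually_ne_atTop 0] with n hn hn0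
  have hn' : (n : ℝ) ≠ 0 := by exact_mod_cast hn0
  rw [eval_natCast_eq_pow_mul_reverse A hn0, Real.log_mul (pow_ne_zero _ hn') hn, Real.log_pow]
  ring

lemma leadingCoeff_pos_of_eval_nonneg (hB0 : B ≠ 0) (hB : ∀ᶠ n : ℕ in atTop, 0 ≤ B.eval (n : ℝ)) :
    0 < B.leadingCoeff := by
  refine lt_of_le_of_ne ?_ (leadingCoeff_ne_zero.2 hB0).symm
  rw [← coeff_zero_reverse]
  refine ge_of_tendsto (tendsto_eval_inv B.reverse) ?_
  filter_upwards [hB, eventually_gt_atTop 0] with n hn hn0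
  rw [eval_natCast_eq_pow_mul_reverse B hn0.ne'] at hn
  exact nonneg_of_mul_nonneg_right hn (by positivity)

/-- The boundary line `Re s = L` is included; this later identifies `zetaDom P` with the open
half-plane. -/
lemma not_dirichletConverges_polynomial (hlam : ∀ n, lam n = A.eval (n : ℝ))
    (hM : ∀ n, (M n : ℝ) = B.eval (n : ℝ)) (hA0 : 0 < A.leadingCoeff) (hB0 : B ≠ 0) {s : ℂ}
    (hs : A.natDegree * s.re ≤ 1 + B.natDegree) :
    ¬ DirichletConverges (fun n => (M n : ℂ)) (fun n => Real.log (lam n)) s := by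
  have hβ := leadingCoeff_pos_of_eval_nonneg hB0 (.of_forall fun n => by rw [← hM]; positivity)
  refine not_dirichletConverges (half_pos hβ) ?_ (κ := Real.log A.leadingCoeff) ?_ hs
  · have h1 := tendsto_eval_inv B.reverse
    rw [coeff_zero_reverse] at h1
    filter_upwards [h1.eventually (le_mem_nhds (half_lt_self hβ)), eventually_ne_atTop 0] with n hn hn0
    rw [hM, eval_natCast_eq_pow_mul_reverse B hn0, mul_comm]
    gcongr
  · simpa only [hlam] using tendsto_log_eval_sub hA0

variable (A B) in
/-- The continuation of `∑_{n ≥ N} B n * (A n) ^ (-s)` to the plane. -/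
noncomputable def continuedTail (N : ℕ) (s : ℂ) : ℂ :=
  (A.leadingCoeff : ℂ) ^ (-s) *
    continuedExpansion A.natDegree B.natDegree N (lowerOrderPart A) B.reverse s

lemma hasSum_continuedTail (hlam : ∀ n, lam n = A.eval (n : ℝ))
    (hM : ∀ n, (M n : ℝ) = B.eval (n : ℝ)) (hA0 : 0 < A.leadingCoeff) {N : ℕ}
    (hN : IsSmallFrom N (lowerOrderPart A)) {s : ℂ} (hs : 1 + B.natDegree < A.natDegree * s.re) :
    HasSum (fun n => (M (n + N) : ℂ) * (lam (n + N) : ℂ) ^ (-s)) (continuedTail A B N s) := by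
  have hA : A ≠ 0 := by rintro rfl; simp at hA0
  have h := hasSum_expansion_zero (d := A.natDegree) (b := B.natDegree) (q := B.reverse) hN
    (s := s) (by linarith)
  rw [← continuedExpansion_eq hN (by push_cast; linarith)] at h
  refine (h.mul_left ((A.leadingCoeff : ℂ) ^ (-s))).congr_fun fun n => ?_
  have hpos := hN.pos
  have hm : n + N ≠ 0 := by omega
  -- This makes `1 + p (1 / n)` positive, so that the complex power splits over the product.
  have h1 := (abs_le.1 (hN.abs_le (n + N) (by omega))).1
  have hm' : ((n + N : ℕ) : ℂ) ≠ 0 := by exact_mod_cast hm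
  rw [hlam, eval_natCast_eq_lowerOrderPart hA hm, Complex.ofReal_mul,
    Complex.mul_cpow_ofReal_nonneg hA0.le (mul_nonneg (by positivity) (by linarith)),
    Complex.ofReal_mul, Complex.mul_cpow_ofReal_nonneg (by positivity) (by linarith),
    ← Complex.ofReal_natCast (M _), hM, eval_natCast_eq_pow_mul_reverse B hm, natCast_pow_cpow,
    ← Complex.cpow_nat_mul]
  have h2 : -(A.natDegree * s - B.natDegree : ℂ) = A.natDegree * -s + B.natDegree := by ring
  rw [h2, Complex.cpow_add _ _ hm', Complex.cpow_natCast]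
  push_cast
  ring

lemma analyticAt_leadingCoeff_cpow (hA0 : 0 < A.leadingCoeff) (s : ℂ) :
    AnalyticAt ℂ (fun s => (A.leadingCoeff : ℂ) ^ (-s)) s :=
  (differentiable_id.neg.const_cpow (Or.inl (by exact_mod_cast hA0.ne'))).analyticAt s

lemma analyticAt_continuedTail (hA0 : 0 < A.leadingCoeff) {N : ℕ}
    (hN : IsSmallFrom N (lowerOrderPart A)) {s : ℂ}
    (hs : ∀ j : ℕ, A.natDegree * s - B.natDegree + j ≠ 1) :
    AnalyticAt ℂ (continuedTail A B N) s :=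
  (analyticAt_leadingCoeff_cpow hA0 s).mul (analyticAt_continuedExpansion hN hs)

lemma orderGE_neg_one_continuedTail (hd : A.natDegree ≠ 0) (hA0 : 0 < A.leadingCoeff) {N : ℕ}
    (hN : IsSmallFrom N (lowerOrderPart A)) (s : ℂ) : OrderGE (-1) (continuedTail A B N) s := by
  simpa using! (OrderGE.of_analyticAt (analyticAt_leadingCoeff_cpow hA0 s)).mul
    (orderGE_neg_one_continuedExpansion hd hN s)

lemma orderGE_zero_continuedTail_neg_natCast (hd : A.natDegree ≠ 0) (hA0 : 0 < A.leadingCoeff)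
    {N : ℕ} (hN : IsSmallFrom N (lowerOrderPart A)) (m : ℕ) :
    OrderGE 0 (continuedTail A B N) (-(m : ℂ)) := by
  simpa using! (OrderGE.of_analyticAt (analyticAt_leadingCoeff_cpow hA0 _)).mul
    (orderGE_zero_continuedExpansion_neg_natCast hd hN (natDegree_lowerOrderPart_le A)
      (reverse_natDegree_le B) m)

lemma polyGrowth_continuedTail (hd : A.natDegree ≠ 0) (hA0 : 0 < A.leadingCoeff) {N : ℕ}
    (hN : IsSmallFrom N (lowerOrderPart A)) (x : ℝ) : PolyGrowth (continuedTail A B N) x :=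
  (polyGrowth_ofReal_cpow_neg hA0 x).mul (polyGrowth_continuedExpansion hd hN x)

end Spectrum

/-! ### Trace of a diagonal operator with summable entries -/

section DiagonalOperator

variable {H : Type*} [NormedAddCommGroup H] [InnerProductSpace ℂ H]

/-- The arithmetic-geometric mean inequality, then Bessel's inequality in each basis. -/
lemma summable_norm_inner_mul_norm_inner {ι : Type*} (a b : HilbertBasis ι ℂ H) (v : H) :
    Summable (fun i => ‖inner ℂ (b i) v‖ * ‖inner ℂ v (a i)‖) ∧
      ∑' i, ‖inner ℂ (b i) v‖ * ‖inner ℂ v (a i)‖ ≤ ‖v‖ ^ 2 := by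
  have ha := a.orthonormal.inner_products_summable v
  have hb := b.orthonormal.inner_products_summable v
  have h : ∀ i, ‖inner ℂ (b i) v‖ * ‖inner ℂ v (a i)‖ ≤
      (‖inner ℂ (b i) v‖ ^ 2 + ‖inner ℂ (a i) v‖ ^ 2) / 2 := fun i => by
    rw [norm_inner_symm v (a i)]
    linarith [two_mul_le_add_sq ‖inner ℂ (b i) v‖ ‖inner ℂ (a i) v‖]
  have hs := (hb.add ha).div_const 2
  have hs' := Summable.of_nonneg_of_le (fun i => by positivity) h hs
  refine ⟨hs', (hs'.tsum_le_tsum h hs).trans ?_⟩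
  rw [tsum_div_const, hb.tsum_add ha]
  linarith [a.orthonormal.tsum_inner_products_le (x := v),
    b.orthonormal.tsum_inner_products_le (x := v)]

variable {κ : Type*} (e : HilbertBasis κ ℂ H) (c : κ → ℂ)

/-- The operator which is diagonal in the Hilbert basis `e` with summable eigenvalues `c`. -/
noncomputable def diagonalOp : H →L[ℂ] H := ∑' p, c p • rankOne ℂ (e p) (e p)

variable {e c}

lemma hasSum_diagonalOp [CompleteSpace H] (hc : Summable fun p => ‖c p‖) (x : H) :
    HasSum (fun p => (c p * inner ℂ (e p) x) • e p) (diagonalOp e c x) := by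
  have h : Summable fun p => c p • rankOne ℂ (e p) (e p) :=
    .of_norm (by simpa [norm_smul, e.orthonormal.1] using hc)
  simpa [mul_smul] using! h.hasSum.mapL (ContinuousLinearMap.apply ℂ H x)

lemma hasSum_inner_diagonalOp [CompleteSpace H] (hc : Summable fun p => ‖c p‖) (x y : H) :
    HasSum (fun p => c p * (inner ℂ y (e p) * inner ℂ (e p) x)) (inner ℂ y (diagonalOp e c x)) := by
  have := (hasSum_diagonalOp (e := e) hc x).mapL (innerSL ℂ y)
  simp only [innerSL_apply_apply, inner_smul_right] at this
  simpa only [mul_assoc, mul_comm (inner ℂ (e _) x)] using this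

lemma diagonalOp_apply_of_forall [CompleteSpace H] (hc : Summable fun p => ‖c p‖) {x : H} {z : ℂ}
    (h : ∀ p, c p = z ∨ inner ℂ (e p) x = 0) : diagonalOp e c x = z • x := by
  refine (hasSum_diagonalOp (e := e) hc x).unique ?_
  have h1 := (e.hasSum_repr x).const_smul z
  convert! h1 using 2 with p
  rw [e.repr_apply_apply, smul_smul]
  rcases h p with h | h <;> simp [h]

/-- Absolute summability of the double series gives the trace class property and, by interchanging
sums, a trace independent of the basis. -/
lemma summable_inner_diagonalOp_prod (hc : Summable fun p => ‖c p‖) {ι : Type*}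
    (a b : HilbertBasis ι ℂ H) : Summable fun q : κ × ι =>
      ‖c q.1 * (inner ℂ (b q.2) (e q.1) * inner ℂ (e q.1) (a q.2))‖ := by
  have h := fun p => summable_norm_inner_mul_norm_inner a b (e p)
  rw [summable_prod_of_nonneg fun _ => norm_nonneg _]
  simp only [norm_mul, tsum_mul_left]
  refine ⟨fun p => (h p).1.mul_left _, .of_nonneg_of_le
    (fun p => mul_nonneg (norm_nonneg _) (tsum_nonneg fun i => by positivity)) (fun p => ?_) hc⟩
  refine mul_le_of_le_one_right (norm_nonneg _) ((h p).2.trans_eq ?_)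
  rw [e.orthonormal.1, one_pow]

lemma summable_norm_inner_diagonalOp [CompleteSpace H] (hc : Summable fun p => ‖c p‖) {ι : Type*}
    (a b : HilbertBasis ι ℂ H) : Summable fun i => ‖inner ℂ (b i) (diagonalOp e c (a i))‖ := by
  have h := (summable_inner_diagonalOp_prod (e := e) hc a b).prod_symm
  refine .of_nonneg_of_le (fun i => norm_nonneg _) (fun i => ?_) h.prod
  rw [← (hasSum_inner_diagonalOp hc (a i) (b i)).tsum_eq]
  exact norm_tsum_le_tsum_norm (h.prod_factor i)

lemma hasSum_trace_diagonalOp [CompleteSpace H] (hc : Summable fun p => ‖c p‖) {ι : Type*}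
    (a : HilbertBasis ι ℂ H) :
    HasSum (fun i => inner ℂ (a i) (diagonalOp e c (a i))) (∑' p, c p) := by
  have h := (summable_inner_diagonalOp_prod (e := e) hc a a).of_norm
  have h1 : ∀ p, HasSum (fun i => c p * (inner ℂ (a i) (e p) * inner ℂ (e p) (a i))) (c p) := by
    intro p
    have h2 := (a.hasSum_inner_mul_inner (e p) (e p)).mul_left (c p)
    rw [inner_self_eq_norm_sq_to_K, e.orthonormal.1] at h2
    simpa [mul_comm (inner ℂ (e p) (a _))] using h2
  have h4 := (Equiv.prodComm ι κ).hasSum_iff.2 h.hasSum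
  rw [(h.hasSum.prod_fiberwise h1).tsum_eq]
  exact h4.prod_fiberwise fun i => hasSum_inner_diagonalOp hc (a i) (a i)

end DiagonalOperator

/-! ### Eigenbasis of `P` and the trace of its powers -/

section Spectral

variable {H : Type u} [NormedAddCommGroup H] [InnerProductSpace ℂ H] {P : H →ₗ.[ℂ] H}

lemma mem_opEigenspace {μ : ℝ} {v : H} :
    v ∈ opEigenspace P μ ↔ ∃ h : v ∈ P.domain, P ⟨v, h⟩ = (μ : ℂ) • v := by
  simp only [opEigenspace, Submodule.mem_map, LinearMap.mem_ker, LinearMap.sub_apply,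
    LinearMap.smul_apply, Submodule.subtype_apply, sub_eq_zero]
  constructor
  · rintro ⟨w, hw, rfl⟩
    exact ⟨w.2, hw⟩
  · rintro ⟨h, hv⟩
    exact ⟨⟨v, h⟩, hv, rfl⟩

variable {lam : ℕ → ℝ} {M : ℕ → ℕ}

/-- The index set counts eigenvalues with multiplicity; it is lifted to the universe of `H` because
the trace is tested on bases indexed there. -/
lemma hasSum_mult_of_hasSum {g : ℕ → ℂ} {τ : ℂ}
    (h : HasSum (fun p : ULift.{u} (Σ n, Fin (M n)) => g p.down.1) τ) :
    HasSum (fun n => (M n : ℂ) * g n) τ := by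
  have h1 : HasSum (fun p : Σ n, Fin (M n) => g p.1) τ := Equiv.ulift.symm.hasSum_iff.2 h
  refine h1.sigma fun n => ?_
  simpa using hasSum_fintype fun _ : Fin (M n) => g n

lemma summable_norm_mult {g : ℕ → ℂ} (h : Summable fun n => (M n : ℂ) * g n) :
    Summable fun p : ULift.{u} (Σ n, Fin (M n)) => ‖g p.down.1‖ := by
  have h1 : Summable fun p : Σ n, Fin (M n) => ‖g p.1‖ := by
    rw [summable_sigma_of_nonneg fun _ => norm_nonneg _]
    exact ⟨fun n => (hasSum_fintype _).summable, by simpa using h.norm⟩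
  exact Equiv.ulift.summable_iff.2 h1

namespace IsPositiveWithCompactInverse

lemma inner_eq_zero (hP : IsPositiveWithCompactInverse P)
    {μ ν : ℝ} (hμν : μ ≠ ν) {v w : H} (hv : v ∈ opEigenspace P μ)
    (hw : w ∈ opEigenspace P ν) : inner ℂ v w = 0 := by
  obtain ⟨hv, hv'⟩ := mem_opEigenspace.1 hv
  obtain ⟨hw, hw'⟩ := mem_opEigenspace.1 hw
  have h := hP.symmetric ⟨v, hv⟩ ⟨w, hw⟩
  rw [hv', hw', inner_smul_left, inner_smul_right, Complex.conj_ofReal] at h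
  have h1 : ((μ : ℂ) - ν) * inner ℂ v w = 0 := by rw [sub_mul, sub_eq_zero]; exact h
  refine (mul_eq_zero.1 h1).resolve_left ?_
  exact sub_ne_zero.2 (by exact_mod_cast hμν)

lemma pos_of_mem (hP : IsPositiveWithCompactInverse P)
    {μ : ℝ} {v : H} (hv : v ∈ opEigenspace P μ) (hv0 : v ≠ 0) : 0 < μ := by
  obtain ⟨K, -, hK, -⟩ := hP.compact_inverse
  obtain ⟨hv, hv'⟩ := mem_opEigenspace.1 hv
  have h1 : 0 ≤ μ * ‖v‖ ^ 2 := by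
    have := hP.nonneg ⟨v, hv⟩
    rw [hv', inner_smul_left, Complex.conj_ofReal, Complex.re_ofReal_mul,
      inner_self_eq_norm_sq_to_K] at this
    exact_mod_cast this
  have h2 : 0 < ‖v‖ ^ 2 := by positivity
  -- The value `μ = 0` is excluded because `P` has a left inverse.
  refine lt_of_le_of_ne (nonneg_of_mul_nonneg_left h1 h2) fun h0 => hv0 ?_
  have h3 := hK ⟨v, hv⟩
  rw [hv', ← h0] at h3
  simpa using h3.symm

/-- The inverse is a compact symmetric operator with the same eigenspaces. -/
lemma exists_inverse (hP : IsPositiveWithCompactInverse P) :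
    ∃ K : H →L[ℂ] H, IsCompactOperator K ∧ K.IsSymmetric ∧
    (∀ μ : ℝ, μ ≠ 0 → opEigenspace P μ = Module.End.eigenspace K.toLinearMap (μ⁻¹ : ℂ)) ∧
    Module.End.eigenspace K.toLinearMap (0 : ℂ) = ⊥ := by
  obtain ⟨K, hKc, hK, hK'⟩ := hP.compact_inverse
  refine ⟨K, hKc, fun x y => ?_, fun μ hμ => ?_, ?_⟩
  · obtain ⟨hx, hx'⟩ := hK' x
    obtain ⟨hy, hy'⟩ := hK' y
    have := hP.symmetric ⟨K x, hx⟩ ⟨K y, hy⟩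
    rw [hx', hy'] at this
    exact this.symm
  · have hμ' : (μ : ℂ) ≠ 0 := by exact_mod_cast hμ
    ext v
    rw [mem_opEigenspace, Module.End.mem_eigenspace_iff]
    constructor
    · rintro ⟨hv, hv'⟩
      have := hK ⟨v, hv⟩
      rw [hv', map_smul] at this
      change K v = _
      rw [eq_inv_smul_iff₀ hμ']
      exact this
    · intro hv
      obtain ⟨h, h'⟩ := hK' v
      have h1 : K ((μ : ℂ) • v) = v := by
        change K v = _ at hv
        rw [map_smul, hv, smul_inv_smul₀ hμ']
      obtain ⟨h, h'⟩ := hK' ((μ : ℂ) • v)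
      simp only [h1] at h h'
      exact ⟨h, h'⟩
  · rw [eq_bot_iff]
    intro v hv
    rw [Module.End.mem_eigenspace_iff, zero_smul] at hv
    obtain ⟨h, h'⟩ := hK' v
    change K v = 0 at hv
    simp only [hv] at h'
    rw [Submodule.mem_bot, ← h']
    exact P.map_zero

lemma finiteDimensional_opEigenspace [CompleteSpace H] (hP : IsPositiveWithCompactInverse P)
    (μ : ℝ) : FiniteDimensional ℂ (opEigenspace P μ) := by
  obtain ⟨K, hKc, -, hK, -⟩ := hP.exists_inverse
  by_cases hμ : μ = 0
  · have : opEigenspace P μ = ⊥ := by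
      rw [eq_bot_iff]
      intro v hv
      by_contra hv0
      exact (hP.pos_of_mem hv hv0).ne' hμ
    rw [this]
    infer_instance
  · rw [hK μ hμ]
    exact ContinuousLinearMap.finite_dimensional_eigenspace hKc _
      (inv_ne_zero (by exact_mod_cast hμ))

/-- The spectral theorem for the compact symmetric inverse: its eigenvalues are real by symmetry and
nonzero by injectivity, so its eigenspaces are among those of `P`. -/
lemma iSup_opEigenspace_orthogonal [CompleteSpace H] (hP : IsPositiveWithCompactInverse P) :
    (⨆ μ : ℝ, opEigenspace P μ)ᗮ = ⊥ := by
  obtain ⟨K, hKc, hKs, hK, hK0⟩ := hP.exists_inverse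
  rw [eq_bot_iff, ← ContinuousLinearMap.orthogonalComplement_iSup_eigenspaces_eq_bot hKc hKs]
  refine Submodule.orthogonal_le (iSup_le fun ν => ?_)
  by_cases hν : Module.End.HasEigenvalue K.toLinearMap ν
  · have h1 := Complex.conj_eq_iff_real.1 (hKs.conj_eigenvalue_eq_self hν)
    obtain ⟨r, rfl⟩ := h1
    have hr : r ≠ 0 := by
      rintro rfl
      exact hν (by simpa using hK0)
    have h2 := hK r⁻¹ (inv_ne_zero hr)
    rw [Complex.ofReal_inv, inv_inv] at h2
    exact h2 ▸ le_iSup (opEigenspace P) r⁻¹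
  · rw [Module.End.hasEigenvalue_iff, not_not] at hν
    exact hν.trans_le bot_le

lemma exists_orthonormalBasis_fiber [CompleteSpace H] (hP : IsPositiveWithCompactInverse P)
    (hspec : HasEigenvaluesWithMult P lam M) (μ : ℝ) :
    ∃ v : {p : ULift.{u} (Σ n, Fin (M n)) // lam p.down.1 = μ} → H,
      Orthonormal ℂ v ∧ Submodule.span ℂ (Set.range v) = opEigenspace P μ := by
  classical
  obtain ⟨hfin, hrank⟩ := hspec μ
  have := hP.finiteDimensional_opEigenspace μ
  set S := hfin.toFinset with hS
  have hmem : ∀ n, n ∈ S ↔ lam n = μ ∧ M n ≠ 0 := by simp [hS]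
  -- Indices with `M n = 0` contribute no vectors, so the fibre is finite even if infinitely many
  -- `n` have `lam n = μ`.
  let E : {p : ULift.{u} (Σ n, Fin (M n)) // lam p.down.1 = μ} ≃ Σ n : S, Fin (M n) :=
    { toFun := fun p => ⟨⟨p.1.down.1, (hmem _).2 ⟨p.2, fun h => (h ▸ p.1.down.2).elim0⟩⟩,
        p.1.down.2⟩
      invFun := fun p => ⟨⟨⟨p.1.1, p.2⟩⟩, ((hmem _).1 p.1.2).1⟩
      left_inv := fun p => rfl
      right_inv := fun p => rfl }
  let _ := Fintype.ofEquiv _ E.symm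
  have hcard : Fintype.card (Σ n : S, Fin (M n)) = Module.finrank ℂ (opEigenspace P μ) := by
    rw [hrank, Fintype.card_sigma]
    simp only [Fintype.card_fin]
    rw [Finset.sum_coe_sort S M]
    refine (finsum_mem_eq_sum_of_inter_support_eq M (s := {n | lam n = μ}) ?_).symm
    ext n
    simp only [Set.mem_inter_iff, Set.mem_ofPred_eq, Function.mem_support, SetLike.mem_coe, hmem]
    tauto
  let b := (stdOrthonormalBasis ℂ (opEigenspace P μ)).reindex
    ((Fintype.equivFinOfCardEq hcard).symm.trans E.symm)
  refine ⟨fun p => b p, ?_, ?_⟩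
  · exact b.orthonormal.comp_linearIsometry (opEigenspace P μ).subtypeₗᵢ
  · have h1 : Set.range (fun p => (b p : H)) = (opEigenspace P μ).subtype '' Set.range b := by
      rw [← Set.range_comp]; rfl
    rw [h1, Submodule.span_image]
    have h2 := b.toBasis.span_eq
    rw [b.coe_toBasis] at h2
    rw [h2, Submodule.map_top, Submodule.range_subtype]

lemma exists_hilbertBasis [CompleteSpace H] (hP : IsPositiveWithCompactInverse P)
    (hspec : HasEigenvaluesWithMult P lam M) :
    ∃ e : HilbertBasis (ULift.{u} (Σ n, Fin (M n))) ℂ H,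
      ∀ p, e p ∈ opEigenspace P (lam p.down.1) := by
  choose v hv hv' using hP.exists_orthonormalBasis_fiber hspec
  set w : ULift.{u} (Σ n, Fin (M n)) → H := fun p => v (lam p.down.1) ⟨p, rfl⟩ with hw
  have hvw : ∀ μ (p : {p : ULift.{u} (Σ n, Fin (M n)) // lam p.down.1 = μ}), v μ p = w p.1 := by
    rintro _ ⟨p, rfl⟩
    rfl
  have hwmem : ∀ p, w p ∈ opEigenspace P (lam p.down.1) := fun p => by
    rw [← hv']
    exact Submodule.subset_span ⟨_, rfl⟩
  have hon : Orthonormal ℂ w := by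
    refine ⟨fun p => (hv _).1 _, fun p q hpq => ?_⟩
    by_cases h : lam p.down.1 = lam q.down.1
    · change inner ℂ (w p) (w q) = 0
      rw [← hvw (lam q.down.1) ⟨p, h⟩, ← hvw (lam q.down.1) ⟨q, rfl⟩]
      exact (hv _).2 fun h' => hpq (congrArg Subtype.val h')
    · exact hP.inner_eq_zero h (hwmem p) (hwmem q)
  have hspan : (Submodule.span ℂ (Set.range w))ᗮ = ⊥ := by
    rw [eq_bot_iff, ← hP.iSup_opEigenspace_orthogonal]
    refine Submodule.orthogonal_le (iSup_le fun μ => ?_)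
    rw [← hv' μ, Submodule.span_le]
    rintro _ ⟨p, rfl⟩
    rw [hvw]
    exact Submodule.subset_span ⟨_, rfl⟩
  exact ⟨HilbertBasis.mkOfOrthogonalEqBot hon hspan, fun p => by
    rw [HilbertBasis.coe_mkOfOrthogonalEqBot]; exact hwmem p⟩

lemma lam_pos [CompleteSpace H] (hP : IsPositiveWithCompactInverse P)
    (hspec : HasEigenvaluesWithMult P lam M) {n : ℕ} (hn : M n ≠ 0) :
    0 < lam n := by
  obtain ⟨e, he⟩ := hP.exists_hilbertBasis hspec
  exact hP.pos_of_mem (he ⟨⟨n, ⟨0, Nat.pos_of_ne_zero hn⟩⟩⟩) (e.orthonormal.ne_zero _)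

/-- Infinite dimension enters the proof only here; `deg A ≠ 0`, the positive leading coefficient of
`A` and `B ≠ 0` are drawn from it. -/
lemma infinite_mult_ne_zero [CompleteSpace H] (hP : IsPositiveWithCompactInverse P)
    (hspec : HasEigenvaluesWithMult P lam M)
    (hH : ¬ FiniteDimensional ℂ H) : {n | M n ≠ 0}.Infinite := by
  intro hfin
  obtain ⟨e, -⟩ := hP.exists_hilbertBasis hspec
  have := hfin.to_subtype
  have : Finite (Σ n, Fin (M n)) := by
    refine Finite.of_injective
      (fun p => (⟨⟨p.1, fun h => (h ▸ p.2).elim0⟩, p.2⟩ : Σ n : {n | M n ≠ 0}, Fin (M n))) ?_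
    rintro ⟨n, i⟩ ⟨m, j⟩ h
    simp only [Sigma.mk.injEq, Subtype.mk.injEq] at h
    obtain ⟨rfl, h⟩ := h
    simpa using h
  have := Fintype.ofFinite (ULift.{u} (Σ n, Fin (M n)))
  exact hH (Module.Basis.finiteDimensional_of_finite e.toOrthonormalBasis.toBasis)

/-- A trace of `P ^ (-s)` is the value of the spectral Dirichlet series. -/
lemma hasSum_of_hasOpTrace [CompleteSpace H] (hP : IsPositiveWithCompactInverse P)
    (hspec : HasEigenvaluesWithMult P lam M) {s τ : ℂ}
    {T : H →L[ℂ] H} (hT : IsOpCpow P (-s) T) (hτ : HasOpTrace T τ) :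
    HasSum (fun n => (M n : ℂ) * (lam n : ℂ) ^ (-s)) τ := by
  obtain ⟨e, he⟩ := hP.exists_hilbertBasis hspec
  refine hasSum_mult_of_hasSum.{u} (g := fun n => (lam n : ℂ) ^ (-s)) ?_
  refine (hτ.2 _ e).congr_fun fun p => ?_
  rw [hT _ _ (he p), inner_smul_right, inner_self_eq_norm_sq_to_K, e.orthonormal.1]
  simp

lemma exists_hasOpTrace [CompleteSpace H] (hP : IsPositiveWithCompactInverse P)
    (hspec : HasEigenvaluesWithMult P lam M) {s : ℂ}
    (hs : Summable fun n => (M n : ℂ) * (lam n : ℂ) ^ (-s)) :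
    ∃ (T : H →L[ℂ] H) (τ : ℂ), IsOpCpow P (-s) T ∧ HasOpTrace T τ := by
  obtain ⟨e, he⟩ := hP.exists_hilbertBasis hspec
  have hc := summable_norm_mult.{u} hs
  refine ⟨diagonalOp e fun p => (lam p.down.1 : ℂ) ^ (-s), _, fun μ v hv => ?_,
    fun ι a b => summable_norm_inner_diagonalOp hc a b, fun ι a => hasSum_trace_diagonalOp hc a⟩
  -- On a whole eigenspace the operator is scalar, since basis vectors of other eigenvalues are
  -- orthogonal to it.
  refine diagonalOp_apply_of_forall hc fun p => ?_
  by_cases h : lam p.down.1 = μ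
  · exact Or.inl (by rw [h])
  · exact Or.inr (hP.inner_eq_zero h (he p) hv)

lemma mem_zetaDom_iff [CompleteSpace H] (hP : IsPositiveWithCompactInverse P)
    (hspec : HasEigenvaluesWithMult P lam M) {s : ℂ} :
    s ∈ zetaDom P ↔ Summable fun n => (M n : ℂ) * (lam n : ℂ) ^ (-s) :=
  ⟨fun ⟨_, _, hT, hτ⟩ => (hP.hasSum_of_hasOpTrace hspec hT hτ).summable,
    hP.exists_hasOpTrace hspec⟩

lemma specZeta_eq_tsum [CompleteSpace H] (hP : IsPositiveWithCompactInverse P)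
    (hspec : HasEigenvaluesWithMult P lam M) {s : ℂ}
    (hs : s ∈ zetaDom P) : specZeta P s = ∑' n, (M n : ℂ) * (lam n : ℂ) ^ (-s) := by
  obtain ⟨T, τ, h⟩ := hs
  have h1 : ∃ τ : ℂ, ∃ T : H →L[ℂ] H, IsOpCpow P (-s) T ∧ HasOpTrace T τ := ⟨τ, T, h⟩
  rw [specZeta, dif_pos h1]
  obtain ⟨T', hT', hτ'⟩ := h1.choose_spec
  exact (hP.hasSum_of_hasOpTrace hspec hT' hτ').tsum_eq.symm

end IsPositiveWithCompactInverse

end Spectral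

lemma toMeromorphicNFOn_isMeromorphicExtension {f F : ℂ → ℂ} {D : Set ℂ}
    (hF : ∀ z, MeromorphicAt F z) (hD : ∀ z ∈ D, AnalyticAt ℂ F z ∧ F z = f z) :
    IsMeromorphicExtension f D (toMeromorphicNFOn F Set.univ) :=
  ⟨meromorphicNFOn_toMeromorphicNFOn F _, fun z hz => by
    rw [toMeromorphicNFOn_univ_apply_of_analyticAt (fun z _ => hF z) (hD z hz).1, (hD z hz).2]⟩

/-! ### The continued zeta function and its poles -/

section Polynomial

variable {A B : ℝ[X]} {lam : ℕ → ℝ} {M : ℕ → ℕ}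

/-- A constant `A` would put infinitely many `n` in one fibre, against finite multiplicity. -/
lemma natDegree_ne_zero_of_finite_fibers (hlam : ∀ n, lam n = A.eval (n : ℝ))
    (hM : {n | M n ≠ 0}.Infinite) (hfin : ∀ μ, {n | lam n = μ ∧ M n ≠ 0}.Finite) :
    A.natDegree ≠ 0 := by
  intro h
  refine hM ((hfin (A.coeff 0)).subset fun n hn => ⟨?_, hn⟩)
  rw [hlam, eq_C_of_natDegree_eq_zero h]
  simp

lemma leadingCoeff_pos_of_infinite_pos (hlam : ∀ n, lam n = A.eval (n : ℝ))
    (h : {n | 0 < lam n}.Infinite) : 0 < A.leadingCoeff := by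
  have hA : A ≠ 0 := by
    rintro rfl
    simp [hlam] at h
  by_contra h0
  have h1 : A.leadingCoeff < 0 := lt_of_le_of_ne (not_lt.1 h0) (leadingCoeff_ne_zero.2 hA)
  rw [← coeff_zero_reverse] at h1
  have h2 := (tendsto_eval_inv A.reverse).eventually (gt_mem_nhds h1)
  obtain ⟨n, hn, hn1, hn2⟩ := ((Nat.frequently_atTop_iff_infinite.2 h).and_eventually
    (h2.and (eventually_ne_atTop 0))).exists
  rw [hlam, eval_natCast_eq_pow_mul_reverse A hn2] at hn
  exact absurd hn (not_lt.2 (mul_nonpos_of_nonneg_of_nonpos (by positivity) hn1.le))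

lemma mult_mul_cpow_neg_eq_exp (h : ∀ n, M n ≠ 0 → 0 < lam n) (s : ℂ) (n : ℕ) :
    (M n : ℂ) * (lam n : ℂ) ^ (-s) = M n * Complex.exp (-s * (Real.log (lam n) : ℝ)) := by
  -- If `M n = 0` then `lam n` may be negative and the two powers differ, but the coefficient kills
  -- both.
  by_cases hn : M n = 0
  · simp [hn]
  · have := h n hn
    rw [Complex.cpow_def_of_ne_zero (by exact_mod_cast this.ne'), ← Complex.ofReal_log this.le,
      mul_comm (-s)]

lemma dirichletConverges_of_summable (h : ∀ n, M n ≠ 0 → 0 < lam n) {s : ℂ}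
    (hs : Summable fun n => (M n : ℂ) * (lam n : ℂ) ^ (-s)) :
    DirichletConverges (fun n => (M n : ℂ)) (fun n => Real.log (lam n)) s := by
  simp only [mult_mul_cpow_neg_eq_exp h] at hs
  exact ⟨_, hs.hasSum.tendsto_sum_nat⟩

lemma summable_mult_mul_cpow (hlam : ∀ n, lam n = A.eval (n : ℝ))
    (hM : ∀ n, (M n : ℝ) = B.eval (n : ℝ)) (hA0 : 0 < A.leadingCoeff) {s : ℂ}
    (hs : 1 + B.natDegree < A.natDegree * s.re) :
    Summable fun n => (M n : ℂ) * (lam n : ℂ) ^ (-s) := by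
  have hA : A ≠ 0 := by rintro rfl; simp at hA0
  obtain ⟨N, -, hN⟩ := exists_isSmallFrom (lowerOrderPart_coeff_zero hA) 0
  exact (summable_nat_add_iff N).1 (hasSum_continuedTail hlam hM hA0 hN hs).summable

lemma natDegree_mul_sub_add_ne_one_of_lt_re {s : ℂ} (hs : 1 + B.natDegree < A.natDegree * s.re)
    (j : ℕ) : (A.natDegree * s - B.natDegree + j : ℂ) ≠ 1 := by
  intro h
  have := congrArg Complex.re h
  simp at this
  linarith [Nat.cast_nonneg (α := ℝ) j]

variable (A B lam M) in
/-- The continuation of `∑ M n * (lam n) ^ (-s)`, with the first `N` terms kept as they are. -/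
noncomputable def continuedZeta (N : ℕ) (s : ℂ) : ℂ :=
  ∑ n ∈ Finset.range N, (M n : ℂ) * (lam n : ℂ) ^ (-s) + continuedTail A B N s

lemma analyticAt_sum_mult_mul_cpow (hlam0 : ∀ n, lam n ≠ 0) (N : ℕ) (s : ℂ) :
    AnalyticAt ℂ (fun s => ∑ n ∈ Finset.range N, (M n : ℂ) * (lam n : ℂ) ^ (-s)) s :=
  Finset.analyticAt_fun_sum _ fun n _ => analyticAt_const.mul
    ((differentiable_id.neg.const_cpow (Or.inl (by exact_mod_cast hlam0 n))).analyticAt s)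

lemma continuedZeta_eq_tsum (hlam : ∀ n, lam n = A.eval (n : ℝ))
    (hM : ∀ n, (M n : ℝ) = B.eval (n : ℝ)) (hA0 : 0 < A.leadingCoeff) {N : ℕ}
    (hN : IsSmallFrom N (lowerOrderPart A)) {s : ℂ} (hs : 1 + B.natDegree < A.natDegree * s.re) :
    continuedZeta A B lam M N s = ∑' n, (M n : ℂ) * (lam n : ℂ) ^ (-s) := by
  rw [continuedZeta, ← (hasSum_continuedTail hlam hM hA0 hN hs).tsum_eq]
  exact (summable_mult_mul_cpow hlam hM hA0 hs).sum_add_tsum_nat_add N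

lemma orderGE_continuedZeta (hlam0 : ∀ n, lam n ≠ 0) {N : ℕ} {k : ℤ} (hk : k ≤ 0) {s : ℂ}
    (h : OrderGE k (continuedTail A B N) s) : OrderGE k (continuedZeta A B lam M N) s :=
  ((OrderGE.of_analyticAt (analyticAt_sum_mult_mul_cpow hlam0 N s)).mono hk).add h

lemma poleSet_continuedZeta (hlam0 : ∀ n, lam n ≠ 0) (hd : A.natDegree ≠ 0)
    (hA0 : 0 < A.leadingCoeff) {N : ℕ} (hN : IsSmallFrom N (lowerOrderPart A)) {z : ℂ}
    (hz : meromorphicOrderAt (continuedZeta A B lam M N) z < 0) :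
    (∃ k : ℕ, z = (1 + (B.natDegree : ℂ) - k) / A.natDegree) ∧ (¬ ∃ m : ℕ, z = -(m : ℂ)) ∧
      meromorphicOrderAt (continuedZeta A B lam M N) z = -1 := by
  refine ⟨?_, ?_, ?_⟩
  · by_contra! h
    refine absurd hz (not_lt.2 (orderGE_continuedZeta hlam0 le_rfl (.of_analyticAt
      (analyticAt_continuedTail hA0 hN fun j hj => h j ?_))).2)
    rw [eq_div_iff (by exact_mod_cast hd)]
    linear_combination hj
  · rintro ⟨m, rfl⟩
    exact absurd hz (not_lt.2 (orderGE_continuedZeta hlam0 le_rfl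
      (orderGE_zero_continuedTail_neg_natCast hd hA0 hN m)).2)
  · have h1 := (orderGE_continuedZeta (M := M) hlam0 (k := -1) (by simp)
      (orderGE_neg_one_continuedTail (B := B) hd hA0 hN z)).2
    generalize meromorphicOrderAt (continuedZeta A B lam M N) z = o at hz h1
    induction o using WithTop.recTopCoe with
    | top => exact absurd hz (by simp)
    | coe a =>
      have h2 : -1 ≤ a := WithTop.coe_le_coe.1 h1
      have h3 : a < 0 := WithTop.coe_lt_coe.1 hz
      rw [show a = -1 by omega]
      rfl

end Polynomial

theorem mainTheorem4 {H : Type u} [NormedAddCommGroup H] [InnerProductSpace ℂ H]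
    [CompleteSpace H] [TopologicalSpace.SeparableSpace H] (hH : ¬ FiniteDimensional ℂ H)
    (P : H →ₗ.[ℂ] H) (hP : IsPositiveWithCompactInverse P)
    (lam : ℕ → ℝ) (M : ℕ → ℕ) (hspec : HasEigenvaluesWithMult P lam M)
    (A B : Polynomial ℝ)
    (hA : ∀ n : ℕ, lam n = A.eval (n : ℝ)) (hB : ∀ n : ℕ, (M n : ℝ) = B.eval (n : ℝ))
    (hroot : ∀ n : ℕ, ¬ A.IsRoot (n : ℝ))
    (L : ℝ) (hL : L = (1 + (B.natDegree : ℝ)) / (A.natDegree : ℝ)) :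
    ((zetaDom P).Nonempty ∧ {s : ℂ | L < s.re} ⊆ zetaDom P ∧
      IsDirichletAbscissa (fun n => (M n : ℂ)) (fun n => Real.log (lam n)) L) ∧
    ∃ Z : ℂ → ℂ,
      IsMeromorphicExtension (specZeta P) (zetaDom P) Z ∧
      (poleSet Z ⊆
          {z : ℂ | ∃ k : ℕ, z = (1 + (B.natDegree : ℂ) - (k : ℂ)) / (A.natDegree : ℂ)} \
            {z : ℂ | ∃ m : ℕ, z = -(m : ℂ)} ∧
        ∀ z ∈ poleSet Z, meromorphicOrderAt Z z = -1) ∧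
      ∀ ε : ℝ, 0 < ε → ∃ N : ℕ, 0 < N ∧ ∃ ZN : ℂ → ℂ,
        IsMeromorphicExtension (truncZeta lam M N) (zetaDom P) ZN ∧
        ∀ x : ℝ,
          Asymptotics.IsBigO (Filter.atTop ⊔ Filter.atBot)
            (fun y : ℝ => ZN ((x : ℂ) + (y : ℂ) * Complex.I))
            (fun y : ℝ => Real.exp (ε * |y|)) := by
  have hinf := hP.infinite_mult_ne_zero hspec hH
  have hpos : ∀ n, M n ≠ 0 → 0 < lam n := fun n hn => hP.lam_pos hspec hn
  have hd : A.natDegree ≠ 0 :=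
    natDegree_ne_zero_of_finite_fibers hA hinf fun μ => (hspec μ).1
  have hA0 : 0 < A.leadingCoeff := leadingCoeff_pos_of_infinite_pos hA (hinf.mono hpos)
  have hAne : A ≠ 0 := leadingCoeff_ne_zero.1 hA0.ne'
  have hBne : B ≠ 0 := by
    rintro rfl
    obtain ⟨n, hn⟩ := hinf.nonempty
    have h := hB n
    rw [eval_zero] at h
    exact hn (by exact_mod_cast h)
  have hlam0 : ∀ n, lam n ≠ 0 := fun n h => hroot n (by rw [IsRoot, ← hA, h])
  have hd' : (0 : ℝ) < A.natDegree := by exact_mod_cast Nat.pos_of_ne_zero hd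
  have hLre : ∀ s : ℂ, L < s.re ↔ 1 + B.natDegree < A.natDegree * s.re := fun s => by
    rw [hL, div_lt_iff₀ hd', mul_comm]
  have hsum : ∀ s : ℂ, L < s.re → Summable fun n => (M n : ℂ) * (lam n : ℂ) ^ (-s) :=
    fun s hs => summable_mult_mul_cpow hA hB hA0 ((hLre s).1 hs)
  have hdiv : ∀ s : ℂ, s.re ≤ L →
      ¬ DirichletConverges (fun n => (M n : ℂ)) (fun n => Real.log (lam n)) s := fun s hs =>
    not_dirichletConverges_polynomial hA hB hA0 hBne
      (not_lt.1 fun h => absurd ((hLre s).2 h) (not_lt.2 hs))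
  have hdom : ∀ s : ℂ, s ∈ zetaDom P ↔ L < s.re := fun s => by
    rw [hP.mem_zetaDom_iff hspec]
    exact ⟨fun h => not_le.1 fun h' => hdiv s h' (dirichletConverges_of_summable hpos h), hsum s⟩
  obtain ⟨N, hN1, hN⟩ := exists_isSmallFrom (lowerOrderPart_coeff_zero hAne) 1
  have hne : ∀ s ∈ zetaDom P, ∀ j : ℕ, (A.natDegree * s - B.natDegree + j : ℂ) ≠ 1 := fun s hs =>
    natDegree_mul_sub_add_ne_one_of_lt_re ((hLre s).1 ((hdom s).1 hs))
  have hmer : ∀ z, MeromorphicAt (continuedTail A B N) z := fun z =>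
    (orderGE_neg_one_continuedTail hd hA0 hN z).1
  have hmerZ : ∀ z, MeromorphicAt (continuedZeta A B lam M N) z := fun z =>
    (analyticAt_sum_mult_mul_cpow hlam0 N z).meromorphicAt.add (hmer z)
  -- Passing to the normal form repairs values at exceptional points and leaves orders unchanged.
  have hpole : ∀ z ∈ poleSet (toMeromorphicNFOn (continuedZeta A B lam M N) Set.univ),
      meromorphicOrderAt (continuedZeta A B lam M N) z < 0 := fun z hz => by
    rwa [poleSet, Set.mem_ofPred_eq,
      meromorphicOrderAt_toMeromorphicNFOn (fun z _ => hmerZ z) (Set.mem_univ z)] at hz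
  refine ⟨⟨⟨(L + 1 : ℝ), (hdom _).2 (by simp)⟩, fun s hs => (hdom s).2 hs,
    fun s hs => dirichletConverges_of_summable hpos (hsum s hs), fun s hs => hdiv s hs.le⟩,
    toMeromorphicNFOn (continuedZeta A B lam M N) Set.univ, ?_, ⟨fun z hz => ?_, fun z hz => ?_⟩,
    fun ε hε => ⟨N, hN1, toMeromorphicNFOn (continuedTail A B N) Set.univ, ?_, fun x => ?_⟩⟩
  · refine toMeromorphicNFOn_isMeromorphicExtension hmerZ fun s hs => ⟨?_, ?_⟩
    · exact (analyticAt_sum_mult_mul_cpow hlam0 N s).add (analyticAt_continuedTail hA0 hN (hne s hs))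
    · rw [hP.specZeta_eq_tsum hspec hs]
      exact continuedZeta_eq_tsum hA hB hA0 hN ((hLre s).1 ((hdom s).1 hs))
  · obtain ⟨h1, h2, -⟩ := poleSet_continuedZeta hlam0 hd hA0 hN (hpole z hz)
    exact ⟨h1, h2⟩
  · rw [meromorphicOrderAt_toMeromorphicNFOn (fun z _ => hmerZ z) (Set.mem_univ z)]
    exact (poleSet_continuedZeta hlam0 hd hA0 hN (hpole z hz)).2.2
  · refine toMeromorphicNFOn_isMeromorphicExtension hmer fun s hs =>
      ⟨analyticAt_continuedTail hA0 hN (hne s hs), ?_⟩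
    exact (hasSum_continuedTail hA hB hA0 hN ((hLre s).1 ((hdom s).1 hs))).tsum_eq.symm
  · refine PolyGrowth.isBigO_exp (PolyGrowth.congr' (polyGrowth_continuedTail (B := B) hd hA0 hN x) ?_) hε
    filter_upwards [eventually_im_ne_zero x] with y hy
    refine (toMeromorphicNFOn_univ_apply_of_analyticAt (fun z _ => hmer z)
      (analyticAt_continuedTail hA0 hN fun j hj => hy ?_)).symm
    have h := congrArg Complex.im hj
    simpa [hd] using h
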